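/- **Setting.** Identify $\mathbf C^d$ with $\mathbf R^{2d}$ through $(x,\xi)\mapsto x+i\xi$. *Weights.* A weight on $\mathbf C^d$ is a positive function $\omega\in L^\infty_{loc}(\mathbf C^d)$ that is bounded from below by a positive constant on every compact set. We write $\omega\in\mathscr P_Q^0(\mathbf C^d)$ if $\omega$ is a weight such that * for some $c,C>0$: $C^{-1}\omega(x)^2\le\omega(x+y)\,\omega(x-y)\le C\omega(x)^2$ whenever $2c\le|x|\le c/|y|$, and * for every $c>0$ there is $C>0$ with $C^{-1}e^{-c|x|^2}\le\omega(x)\le Ce^{c|x|^2}$ for all $x$. The weight $\omega$ is *dilated suitable* if for some $\varepsilon\in(0,1]$ (equivalently, for $\varepsilon=1$) there are $C>0$ and $\theta\in(0,1)$ such that $$\frac{\omega(2^{1/2}x)\,e^{-\varepsilon(1-\lambda^2)|x|^2/2}}{\omega(2^{1/2}\lambda x)}\le C,\qquad 1-\theta<\lambda<1,\ x\in\mathbf C^d .$$ *Mixed quasi-norm spaces.* Let $V_1,\dots,V_n$ be real subspaces of $\mathbf C^d\simeq\mathbf R^{2d}$ with $V_1\oplus\cdots\oplus V_n=\mathbf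 R^{2d}$, and let $p_1,\dots,p_n\in(0,\infty]$. The mixed quasi-norm space $\mathscr B=L^p(V)$ has the quasi-norm obtained by taking successively the $L^{p_1}(V_1)$, $L^{p_2}(V_2)$, …, $L^{p_n}(V_n)$ quasi-norms in the corresponding components (first $V_1$, innermost). Put $\nu_1(\mathscr B)=\min_j p_j$ and $\nu_2(\mathscr B)=\max_j p_j$. If $\nu_1(\mathscr B)\ge1$, let $\mathscr B'=L^{p'}(V)$ with $1/p_j+1/p_j'=1$. *Spaces of entire functions.* For a function $F$ on $\mathbf C^d$ let $$(U^{-1}F)(x,\xi)=(2\pi)^{-d/2}e^{-(|x|^2+|\xi|^2)/4}e^{-i\langle x,\xi\rangle/2}F(2^{-1/2}x-i\,2^{-1/2}\xi).$$ $A(\omega,\mathscr B)$ is the space of all entire functions $F$ on $\mathbf C^d$ such that $\|F\|_{A(\omega,\mathscr B)}=\|(U^{-1}F)\,\omega\|_{\mathscr B}<\infty$. Let $P(\mathbf C^d)$ be the set of polynomials in $z_1,\dots,z_d$. If $\nu_1(\mathscr B)\ge1$, the weak$^*$ topology on $A(\omega,\mathscr B')$ is the coarsest topology for which all the maps $$G\mapsto(G,F)_{A^2}=\pi^{-d}\int_{\mathbf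 C^d}G(z)\overline{F(z)}\,e^{-|z|^2}\,d\lambda(z),\qquad F\in A(1/\omega,\mathscr B),$$ are continuous, where $d\lambda$ is the Lebesgue measure. **Theorem.** Let $\omega\in\mathscr P_Q^0(\mathbf C^d)$ be dilated suitable and let $\mathscr B$ be a mixed quasi-norm space on $\mathbf C^d$ with $\nu_2(\mathscr B)<\infty$. Then the following is true. 1. $P(\mathbf C^d)$ is contained and dense in $A(\omega,\mathscr B)$. If in addition $\nu_1(\mathscr B)\ge1$, then the integrals $(G,F)_{A^2}$ with $G\in A(\omega,\mathscr B')$ and $F\in A(1/\omega,\mathscr B)$ converge absolutely, and $P(\mathbf C^d)$ is contained in $A(\omega,\mathscr B')$ and dense there with respect to the weak$^*$ topology. 2. If $F\in A(\omega,\mathscr B)$, then $F(\lambda\,\cdot\,)\in A(\omega,\mathscr B)$ for $0<\lambda<1$, and $\|F(\lambda\,\cdot\,)-F\|_{A(\omega,\mathscr B)}\to0$ as $\lambda\to1-$. If in addition $\nu_1(\mathscr B)\ge1$ and $G\in A(\omega,\mathscr B')$, then $G(\lambda\,\cdot\,)\in A(\omega,\mathscr B')$ for $0<\lambda<1$, and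 $G(\lambda\,\cdot\,)\to G$ in the weak$^*$ topology of $A(\omega,\mathscr B')$ as $\lambda\to1-$. -/

import Mathlib

open MeasureTheory Filter Set
open scoped ENNReal Topology ComplexConjugate

noncomputable section

namespace BargmannFock

/-- The space `ℂ^d` with its Euclidean norm, identified with `ℝ^{2d}` through
`(x, ξ) ↦ x + i ξ`. -/
abbrev Cd (d : ℕ) : Type := EuclideanSpace ℂ (Fin d)

/-! ### Weights -/

/-- A weight on `ℂ^d ≃ ℝ^{2d}`: a positive function in `L^∞_loc` which is bounded from below by a
positive constant on every compact set. -/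
structure IsWeight {d : ℕ} (ω : Cd d → ℝ) : Prop where
  pos : ∀ x, 0 < ω x
  aemeasurable : AEMeasurable ω volume
  locBounded : ∀ K : Set (Cd d), IsCompact K → ∃ C : ℝ, ∀ᵐ x ∂volume, x ∈ K → ω x ≤ C
  locBoundedBelow : ∀ K : Set (Cd d), IsCompact K → ∃ c : ℝ, 0 < c ∧ ∀ x ∈ K, c ≤ ω x

/-- The class `𝒫_Q^0` of weights of weakly subgaussian type. In the first condition the
requirement `|x| ≤ c / |y|` is written as `|x| |y| ≤ c`, so that `y = 0` is allowed. -/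
structure IsWeaklySubgaussian {d : ℕ} (ω : Cd d → ℝ) : Prop where
  isWeight : IsWeight ω
  relaxedModerate : ∃ c C : ℝ, 0 < c ∧ 0 < C ∧ ∀ x y : Cd d,
    2 * c ≤ ‖x‖ → ‖x‖ * ‖y‖ ≤ c →
      C⁻¹ * ω x ^ 2 ≤ ω (x + y) * ω (x - y) ∧ ω (x + y) * ω (x - y) ≤ C * ω x ^ 2
  subgaussian : ∀ c : ℝ, 0 < c → ∃ C : ℝ, 0 < C ∧ ∀ x : Cd d,
    C⁻¹ * Real.exp (-(c * ‖x‖ ^ 2)) ≤ ω x ∧ ω x ≤ C * Real.exp (c * ‖x‖ ^ 2)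

/-- `ω` is dilated suitable with respect to `ε`. -/
def DilatedSuitableWith {d : ℕ} (ω : Cd d → ℝ) (ε : ℝ) : Prop :=
  ∃ C θ : ℝ, 0 < C ∧ 0 < θ ∧ θ < 1 ∧ ∀ t : ℝ, 1 - θ < t → t < 1 → ∀ x : Cd d,
    ω (Real.sqrt 2 • x) * Real.exp (-(ε * (1 - t ^ 2) * ‖x‖ ^ 2 / 2)) /
      ω ((Real.sqrt 2 * t) • x) ≤ C

/-- `ω` is dilated suitable, i.e. with respect to some `ε ∈ (0, 1]`. The condition gets weaker
when `ε` grows, so this is the same as being dilated suitable with respect to `ε = 1`. -/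
def DilatedSuitable {d : ℕ} (ω : Cd d → ℝ) : Prop :=
  ∃ ε : ℝ, 0 < ε ∧ ε ≤ 1 ∧ DilatedSuitableWith ω ε

/-! ### Mixed quasi-norm spaces -/

/-- The Lebesgue measure on a real subspace of `ℂ^d`, with the Euclidean normalisation. (The
`volume` of the subtype would be the restriction of the ambient volume, which is zero on
proper subspaces.) -/
def lebesgue {d : ℕ} (W : Submodule ℝ (Cd d)) : Measure W :=
  (stdOrthonormalBasis ℝ W).toBasis.addHaar

/-- The iterated quasi-norm of `L^p(V)`. The innermost quasi-norm is taken over `V 0`: the function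
`x ↦ ‖f (x + ·)‖_{L^{p 0}(V 0)}` depends only on the components of `x` in
`V 1, …, V (n - 1)`, and it is measured by the remaining quasi-norms. At the end nothing is left
but the constant obtained, which is evaluated at the origin. -/
def mixedNorm {d : ℕ} : (n : ℕ) → (Fin n → Submodule ℝ (Cd d)) → (Fin n → ℝ≥0∞) →
    (Cd d → ℝ≥0∞) → ℝ≥0∞
  | 0, _, _, f => f 0
  | n + 1, V, p, f =>
      mixedNorm n (Fin.tail V) (Fin.tail p)
        (fun x => eLpNorm (fun y : V 0 => f (x + (y : Cd d))) (p 0) (lebesgue (V 0)))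

/-- The data `(V, p)` of a mixed quasi-norm space `ℬ = L^p(V)` on `ℂ^d ≃ ℝ^{2d}`: real subspaces
whose direct sum is the whole space, and exponents in `(0, ∞]`. -/
structure MixedSpace (d : ℕ) where
  n : ℕ
  V : Fin n → Submodule ℝ (Cd d)
  p : Fin n → ℝ≥0∞
  isInternal : DirectSum.IsInternal V
  p_pos : ∀ j, 0 < p j

namespace MixedSpace

variable {d : ℕ}

/-- The minimal exponent `ν₁(ℬ)`. -/
def nu1 (B : MixedSpace d) : ℝ≥0∞ := ⨅ j, B.p j

/-- The maximal exponent `ν₂(ℬ)`. -/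
def nu2 (B : MixedSpace d) : ℝ≥0∞ := ⨆ j, B.p j

/-- The quasi-norm `‖f‖_ℬ ∈ [0, ∞]` of a function. -/
def qnorm (B : MixedSpace d) (f : Cd d → ℂ) : ℝ≥0∞ := mixedNorm B.n B.V B.p (fun z => ‖f z‖ₑ)

/-- `ℬ' = L^{p'}(V)` with `1 / p j + 1 / p' j = 1` (meaningful when all `p j ≥ 1`). -/
def dual (B : MixedSpace d) : MixedSpace d where
  n := B.n
  V := B.V
  p := fun j => ENNReal.conjExponent (B.p j)
  isInternal := B.isInternal
  p_pos := fun _ => lt_of_lt_of_le one_pos le_self_add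

end MixedSpace

/-! ### The spaces of entire functions -/

/-- Componentwise complex conjugation on `ℂ^d`. -/
def conjVec {d : ℕ} (z : Cd d) : Cd d := WithLp.toLp 2 (fun j => conj (z j))

/-- The inverse of the operator
`(U G)(x, ξ) = (2π)^{d/2} e^{(|x|² + |ξ|²)/2} e^{-i⟨x, ξ⟩} G(2^{1/2} x, -2^{1/2} ξ)`, that is
`(U⁻¹ F)(x, ξ)
  = (2π)^{-d/2} e^{-(|x|² + |ξ|²)/4} e^{-i⟨x, ξ⟩/2} F(2^{-1/2} x, -2^{-1/2} ξ)`,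
where `(x, ξ)` is written as `z = x + i ξ`. -/
def bargmannInv {d : ℕ} (F : Cd d → ℂ) (z : Cd d) : ℂ :=
  (((2 * Real.pi) ^ (-(d : ℝ) / 2) * Real.exp (-(‖z‖ ^ 2 / 4)) : ℝ) : ℂ) *
    Complex.exp (-(Complex.I * ((∑ j, (z j).re * (z j).im : ℝ) : ℂ) / 2)) *
    F ((Real.sqrt 2)⁻¹ • conjVec z)

/-- The quasi-norm `‖F‖_{A(ω, ℬ)} = ‖(U⁻¹ F) ω‖_ℬ ∈ [0, ∞]`. -/
def normA {d : ℕ} (ω : Cd d → ℝ) (B : MixedSpace d) (F : Cd d → ℂ) : ℝ≥0∞ :=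
  B.qnorm (fun z => bargmannInv F z * (ω z : ℂ))

/-- The space `A(ω, ℬ)` of entire functions with finite quasi-norm (entire functions are
continuous, hence in `L^r_loc` for all `r > 0`). -/
def A {d : ℕ} (ω : Cd d → ℝ) (B : MixedSpace d) : Set (Cd d → ℂ) :=
  {F | Differentiable ℂ F ∧ normA ω B F < ∞}

/-- The set `P(ℂ^d)` of polynomial functions in `z_1, …, z_d`. -/
def polynomials (d : ℕ) : Set (Cd d → ℂ) :=
  {F | ∃ P : MvPolynomial (Fin d) ℂ, F = fun z => MvPolynomial.eval (fun j => z j) P}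

/-- The dilation `F(t ·)`. -/
def dilate {d : ℕ} (t : ℝ) (F : Cd d → ℂ) : Cd d → ℂ := fun z => F (t • z)

/-- The integrand of the `A²` form with respect to the Lebesgue measure:
`π^{-d} G(z) \overline{F(z)} e^{-|z|²}`. -/
def formIntegrand {d : ℕ} (G F : Cd d → ℂ) (z : Cd d) : ℂ :=
  G z * conj (F z) * (((Real.pi ^ d)⁻¹ * Real.exp (-‖z‖ ^ 2) : ℝ) : ℂ)

/-- The `A²` form `(G, F)_{A²} = ∫ G \overline F dμ`, `dμ = π^{-d} e^{-|z|²} dλ(z)`. -/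
def formA2 {d : ℕ} (G F : Cd d → ℂ) : ℂ := ∫ z, formIntegrand G F z

/-- The weak* topology on `A(ω, ℬ')`: the coarsest topology for which the maps
`G ↦ (G, F)_{A²}`, `F ∈ A(1/ω, ℬ)`, are continuous. -/
@[reducible] def weakStar {d : ℕ} (ω : Cd d → ℝ) (B : MixedSpace d) : TopologicalSpace (A ω B.dual) :=
  ⨅ F : A (fun z => (ω z)⁻¹) B,
    TopologicalSpace.induced (fun G : A ω B.dual => formA2 G.1 F.1) inferInstance

end BargmannFock

end

open BargmannFock

noncomputable section

namespace BargmannFock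

/-! ### Lebesgue quasi-norms of `[0, ∞]`-valued functions -/

section ELpNorm

variable {α : Type*} [MeasurableSpace α] {μ : Measure α}

/-! Write $F_t=F(t\,\cdot)$. For $t<1$ the dilate $F_t$ has room to spare in its growth, so it is a
limit of polynomials, and it remains to let $t\to1$.

Growth (`exists_growth_of_mem_A`): every $F\in A(\omega,\mathscr B)$ satisfies $|F(w)|\le
Ce^{a|w|^2}$ for each $a>1/2$. A subgaussian weight costs only an arbitrarily small Gaussian,
Hölder's inequality passes from $L^p(V)$ to a plain $L^r$ with $r\le\min p_j$, and $|F|^r$ has the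
sub-mean value property for every $r>0$ by Jensen's formula. Hence $F_t$ grows at most like
$e^{\kappa|w|^2}$ with some $\kappa<1/2$. By Cauchy's estimates its homogeneous expansion converges
geometrically in a slightly weaker Gaussian supremum norm, still with exponent below $1/2$, and such
a norm dominates that of $A(\omega,\mathscr B)$. So $F_t$ is a norm limit of polynomials, also when
some exponents are infinite (`exists_polynomial_normA_lt`).

Convergence $F_t\to F$ (`tendsto_normA_dilate_sub`): dilated suitability bounds
$|(U^{-1}F_t)\,\omega|$ at $z$ by a constant times $|(U^{-1}F)\,\omega|$ at $tz$, for $t$ near 1.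
The tails are therefore uniformly small, by dominated convergence with finite exponents, and on
balls the convergence is uniform. In $\mathscr B'$ an exponent may be infinite and the tails of $G$
need not be small; in $(G_t-G,F)_{A^2}$ the tail is put on $F\in A(1/\omega,\mathscr B)$ instead
(`tendsto_formA2_dilate`).

The iterated quasi-norms see slices while $\omega$ is only a.e. measurable.
`exists_mixedMeasure_eq_smul` makes this harmless: the iterated integral is a positive multiple of
Lebesgue measure. -/

lemma eLpNorm_const_mul_le (c : NNReal) (f : α → ℝ≥0∞) (p : ℝ≥0∞) :
    eLpNorm (fun x => c * f x) p μ ≤ c * eLpNorm f p μ := by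
  simpa [ENNReal.smul_def] using eLpNorm_le_nnreal_smul_eLpNorm_of_ae_le_mul'
    (f := fun x => c * f x) (g := f) (c := c) (μ := μ) (.of_forall fun x => by simp) p

/-- All exponents in `[0, ∞]` are allowed, in particular those below 1, because the target exponent
`r` is chosen below every `p j` in the growth estimate. -/
lemma eLpNorm_mul_le {p q r : ℝ≥0∞} [hpqr : ENNReal.HolderTriple p q r] {f g : α → ℝ≥0∞}
    (hf : AEMeasurable f μ) (hg : AEMeasurable g μ) :
    eLpNorm (fun x => f x * g x) r μ ≤ eLpNorm f p μ * eLpNorm g q μ := by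
  -- An infinite exponent is treated apart, by pulling out the essential supremum; this serves both
  -- `p = ∞` and `q = ∞`.
  have key : ∀ {f g : α → ℝ≥0∞}, AEMeasurable f μ →
      eLpNorm (fun x => f x * g x) r μ ≤ eLpNorm f r μ * eLpNorm g ∞ μ := by
    intro f g hf
    rcases eq_or_ne r 0 with rfl | h0
    · simp
    rcases eq_or_ne r ∞ with rfl | htop
    · simp only [eLpNorm_exponent_top, eLpNormEssSup, enorm_eq_self]
      exact ENNReal.essSup_mul_le (μ := μ) f g
    have hr : 0 < r.toReal := ENNReal.toReal_pos h0 htop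
    rw [eLpNorm_eq_lintegral_rpow_enorm_toReal h0 htop,
      eLpNorm_eq_lintegral_rpow_enorm_toReal h0 htop]
    calc (∫⁻ x, ‖f x * g x‖ₑ ^ r.toReal ∂μ) ^ (1 / r.toReal)
        ≤ (∫⁻ x, f x ^ r.toReal * (eLpNorm g ∞ μ) ^ r.toReal ∂μ) ^ (1 / r.toReal) := by
          gcongr ?_ ^ _
          refine lintegral_mono_ae ?_
          filter_upwards [ae_le_eLpNormEssSup (f := g) (μ := μ)] with x hx
          rw [eLpNorm_exponent_top, enorm_eq_self, ENNReal.mul_rpow_of_nonneg _ _ hr.le]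
          gcongr
          simpa using hx
      _ = _ := by
          rw [lintegral_mul_const'' _ (hf.pow_const _),
            ENNReal.mul_rpow_of_nonneg _ _ (by positivity), ← ENNReal.rpow_mul,
            mul_one_div_cancel hr.ne', ENNReal.rpow_one]
          simp
  have hpqr := hpqr.one_div_eq
  obtain (rfl | rfl | hp) := ENNReal.trichotomy p
  · simp_all
  · have : r = q := by simpa using hpqr
    subst this
    simpa only [mul_comm] using key (g := f) hg
  obtain (rfl | rfl | hq) := ENNReal.trichotomy q
  · simp_all
  · have : r = p := by simpa using hpqr
    subst this
    exact key hf
  obtain ⟨hp₁, hp₂⟩ := ENNReal.toReal_pos_iff.mp hp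
  obtain ⟨hq₁, hq₂⟩ := ENNReal.toReal_pos_iff.mp hq
  have hpqr' : 1 / r.toReal = 1 / p.toReal + 1 / q.toReal := by
    have := congr(ENNReal.toReal $(hpqr))
    rw [ENNReal.toReal_add (by simpa using hp₁.ne') (by simpa using hq₁.ne')] at this
    simpa
  have hr : 0 < r.toReal := one_div_pos.mp <| by rw [hpqr']; positivity
  obtain ⟨hr₁, hr₂⟩ := ENNReal.toReal_pos_iff.mp hr
  have hrp : r.toReal < p.toReal := lt_of_one_div_lt_one_div hp <|
    hpqr' ▸ lt_add_of_pos_right _ (by positivity)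
  rw [eLpNorm_eq_lintegral_rpow_enorm_toReal hr₁.ne' hr₂.ne,
    eLpNorm_eq_lintegral_rpow_enorm_toReal hp₁.ne' hp₂.ne,
    eLpNorm_eq_lintegral_rpow_enorm_toReal hq₁.ne' hq₂.ne]
  simpa using ENNReal.lintegral_Lp_mul_le_Lq_mul_Lr hr hrp hpqr' μ hf hg

lemma ae_lt_top_of_eLpNorm_lt_top {p : ℝ≥0∞} (hp : p ≠ 0) {f : α → ℝ≥0∞} (hf : AEMeasurable f μ)
    (h : eLpNorm f p μ < ∞) : ∀ᵐ x ∂μ, f x < ∞ := by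
  rcases eq_or_ne p ∞ with rfl | htop
  · filter_upwards [ae_le_eLpNormEssSup (f := f) (μ := μ)] with x hx
    simpa using hx.trans_lt (by simpa using h)
  have hr : 0 < p.toReal := ENNReal.toReal_pos hp htop
  have := lintegral_rpow_enorm_lt_top_of_eLpNorm_lt_top hp htop h
  filter_upwards [ae_lt_top' (by simpa using hf.pow_const _) this.ne] with x hx
  simpa [ENNReal.rpow_lt_top_iff_of_pos hr] using hx

lemma tendsto_eLpNorm_zero {p : ℝ≥0∞} (hp : p ≠ 0) (hp' : p ≠ ∞) {f : ℕ → α → ℝ≥0∞}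
    {F : α → ℝ≥0∞} (hf : ∀ k, AEMeasurable (f k) μ) (hfF : ∀ k, ∀ᵐ x ∂μ, f k x ≤ F x)
    (hF : eLpNorm F p μ < ∞) (hlim : ∀ᵐ x ∂μ, Tendsto (fun k => f k x) atTop (𝓝 0)) :
    Tendsto (fun k => eLpNorm (f k) p μ) atTop (𝓝 0) := by
  have hr : 0 < p.toReal := ENNReal.toReal_pos hp hp'
  have h := tendsto_lintegral_of_dominated_convergence' (μ := μ)
    (F := fun k x => f k x ^ p.toReal) (f := fun _ => 0) (fun x => F x ^ p.toReal)
    (fun k => (hf k).pow_const _)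
    (fun k => by filter_upwards [hfF k] with x hx; gcongr)
    (by simpa using (lintegral_rpow_enorm_lt_top_of_eLpNorm_lt_top hp hp' hF).ne)
    (by
      filter_upwards [hlim] with x hx
      simpa [hr] using hx.ennrpow_const p.toReal)
  have h2 := h.ennrpow_const (1 / p.toReal)
  simpa [eLpNorm_eq_lintegral_rpow_enorm_toReal hp hp', hr] using h2

lemma measurable_eLpNorm_right {β : Type*} [MeasurableSpace β] [SFinite μ] {f : β × α → ℝ≥0∞}
    (hf : Measurable f) (p : ℝ≥0∞) : Measurable fun x => eLpNorm (fun y => f (x, y)) p μ := by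
  rcases eq_or_ne p 0 with rfl | h0
  · simp
  rcases eq_or_ne p ∞ with rfl | htop
  · refine measurable_of_Ioi fun a => ?_
    -- The essential supremum of a slice exceeds `a` exactly when the slice of `{f > a}` has
    -- positive measure, and that measure is measurable in `x`.
    have : (fun x => eLpNorm (fun y => f (x, y)) ∞ μ) ⁻¹' Ioi a
        = (fun x => μ (Prod.mk x ⁻¹' {z | a < f z})) ⁻¹' {0}ᶜ := by
      ext x
      simp only [mem_preimage, mem_Ioi, mem_compl_iff, mem_singleton_iff]
      rw [← not_le, not_iff_not]
      have h1 : μ (Prod.mk x ⁻¹' {z | a < f z}) = 0 ↔ ∀ᵐ y ∂μ, f (x, y) ≤ a := by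
        rw [ae_iff]; simp [preimage]
      rw [h1, eLpNorm_exponent_top]
      constructor
      · intro h
        filter_upwards [ae_le_eLpNormEssSup (f := fun y => f (x, y)) (μ := μ)] with y hy
        simpa using hy.trans h
      · intro h
        exact eLpNormEssSup_le_of_ae_enorm_bound (by simpa using h)
    rw [this]
    exact measurable_measure_prodMk_left (hf measurableSet_Ioi) (measurableSet_singleton _).compl
  · simp_rw [eLpNorm_eq_lintegral_rpow_enorm_toReal h0 htop]
    refine Measurable.pow_const ?_ _
    exact Measurable.lintegral_prod_right' (f := fun z => ‖f z‖ₑ ^ p.toReal)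
      (by simpa using hf.pow_const _)

end ELpNorm

/-! ### Iterated quasi-norms -/

section Mixed

variable {d : ℕ}

instance (W : Submodule ℝ (Cd d)) : (lebesgue W).IsAddHaarMeasure := by
  unfold lebesgue; infer_instance

/-- The measure of the iterated integral over `V (n - 1), …, V 0`. -/
def mixedMeasure : (n : ℕ) → (Fin n → Submodule ℝ (Cd d)) → Measure (Cd d)
  | 0, _ => Measure.dirac 0
  | n + 1, V => mixedMeasure n (Fin.tail V) ∗ (lebesgue (V 0)).map (fun y : V 0 => (y : Cd d))

lemma measurable_eLpNorm_translate (W : Submodule ℝ (Cd d)) {f : Cd d → ℝ≥0∞} (hf : Measurable f)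
    (p : ℝ≥0∞) : Measurable fun x => eLpNorm (fun y : W => f (x + (y : Cd d))) p (lebesgue W) :=
  measurable_eLpNorm_right (f := fun z : Cd d × W => f (z.1 + z.2)) (by fun_prop) p

lemma lintegral_mixedMeasure_succ {n : ℕ} (V : Fin (n + 1) → Submodule ℝ (Cd d))
    {f : Cd d → ℝ≥0∞} (hf : Measurable f) :
    ∫⁻ z, f z ∂mixedMeasure (n + 1) V
      = ∫⁻ x, ∫⁻ y : V 0, f (x + (y : Cd d)) ∂lebesgue (V 0) ∂mixedMeasure n (Fin.tail V) := by
  rw [mixedMeasure, Measure.lintegral_conv hf]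
  refine lintegral_congr fun x => ?_
  rw [lintegral_map (by fun_prop) (by fun_prop)]

/-- Fubini for null sets. `P` need not be measurable, since the exceptional set is first enlarged to
a measurable null set; the converse below does require measurability. -/
lemma ae_mixedMeasure_succ {n : ℕ} {V : Fin (n + 1) → Submodule ℝ (Cd d)} {P : Cd d → Prop}
    (h : ∀ᵐ z ∂mixedMeasure (n + 1) V, P z) :
    ∀ᵐ x ∂mixedMeasure n (Fin.tail V), ∀ᵐ y : V 0 ∂lebesgue (V 0), P (x + (y : Cd d)) := by
  obtain ⟨s, hs, hsm, hs0⟩ := exists_measurable_superset_of_null (ae_iff.1 h)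
  have h1 := lintegral_mixedMeasure_succ V (measurable_one.indicator hsm)
  rw [lintegral_indicator_one hsm, hs0, eq_comm, lintegral_eq_zero_iff] at h1
  · filter_upwards [h1] with x hx
    rw [Pi.zero_apply, lintegral_eq_zero_iff] at hx
    · filter_upwards [hx] with y hy
      by_contra hP
      have : x + (y : Cd d) ∈ s := hs hP
      simp [this] at hy
    · exact (measurable_one.indicator hsm).comp (by fun_prop)
  · have := measurable_eLpNorm_translate (V 0) (measurable_one.indicator hsm) 1
    simpa [eLpNorm_one_eq_lintegral_enorm] using this

lemma ae_mixedMeasure_succ_of_ae_ae {n : ℕ} {V : Fin (n + 1) → Submodule ℝ (Cd d)}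
    {P : Cd d → Prop} (hP : MeasurableSet {z | P z})
    (h : ∀ᵐ x ∂mixedMeasure n (Fin.tail V), ∀ᵐ y : V 0 ∂lebesgue (V 0), P (x + (y : Cd d))) :
    ∀ᵐ z ∂mixedMeasure (n + 1) V, P z := by
  change mixedMeasure (n + 1) V {z | P z}ᶜ = 0
  rw [← lintegral_indicator_one hP.compl,
    lintegral_mixedMeasure_succ V (measurable_one.indicator hP.compl)]
  refine lintegral_eq_zero_of_ae_eq_zero ?_
  filter_upwards [h] with x hx
  refine lintegral_eq_zero_of_ae_eq_zero ?_
  filter_upwards [hx] with y hy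
  simp [hy]

/-- With equal exponents each inner root is undone by the next outer power, so one integral remains.
This links mixed quasi-norms to ordinary integrals. -/
lemma mixedNorm_const_exponent {n : ℕ} (V : Fin n → Submodule ℝ (Cd d)) {r : ℝ} (hr : 0 < r)
    {f : Cd d → ℝ≥0∞} (hf : Measurable f) :
    mixedNorm n V (fun _ => ENNReal.ofReal r) f = (∫⁻ z, f z ^ r ∂mixedMeasure n V) ^ (1 / r) := by
  induction n generalizing f with
  | zero =>
    rw [mixedNorm, mixedMeasure, lintegral_dirac' _ (by fun_prop), ← ENNReal.rpow_mul,
      mul_one_div_cancel hr.ne', ENNReal.rpow_one]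
  | succ n ih =>
    rw [lintegral_mixedMeasure_succ V (by fun_prop), mixedNorm]
    refine (ih (Fin.tail V) (measurable_eLpNorm_translate (V 0) hf (ENNReal.ofReal r))).trans ?_
    congr 1
    refine lintegral_congr fun x => ?_
    rw [eLpNorm_eq_lintegral_rpow_enorm_toReal (by simpa using hr) ENNReal.ofReal_ne_top,
      ENNReal.toReal_ofReal hr.le, ← ENNReal.rpow_mul, one_div_mul_cancel hr.ne', ENNReal.rpow_one]
    rfl

lemma mixedNorm_mono_ae {n : ℕ} {V : Fin n → Submodule ℝ (Cd d)} {p : Fin n → ℝ≥0∞}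
    {f g : Cd d → ℝ≥0∞} (h : ∀ᵐ z ∂mixedMeasure n V, f z ≤ g z) :
    mixedNorm n V p f ≤ mixedNorm n V p g := by
  induction n generalizing f g with
  | zero =>
    by_contra hc
    have h1 : Measure.dirac (0 : Cd d) {z | ¬ f z ≤ g z} = 0 := h
    have h2 := Measure.dirac_apply_of_mem (a := (0 : Cd d)) (s := {z | ¬ f z ≤ g z}) hc
    rw [h1] at h2
    simp at h2
  | succ n ih =>
    refine ih ?_
    filter_upwards [ae_mixedMeasure_succ h] with x hx
    exact eLpNorm_mono_enorm_ae (by simpa using hx)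

lemma mixedNorm_mono {n : ℕ} {V : Fin n → Submodule ℝ (Cd d)} {p : Fin n → ℝ≥0∞}
    {f g : Cd d → ℝ≥0∞} (h : ∀ z, f z ≤ g z) : mixedNorm n V p f ≤ mixedNorm n V p g :=
  mixedNorm_mono_ae (.of_forall h)

lemma mixedNorm_const_mul_le {n : ℕ} {V : Fin n → Submodule ℝ (Cd d)} {p : Fin n → ℝ≥0∞}
    (c : NNReal) (f : Cd d → ℝ≥0∞) :
    mixedNorm n V p (fun z => c * f z) ≤ c * mixedNorm n V p f := by
  induction n generalizing f with
  | zero => simp [mixedNorm]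
  | succ n ih =>
    refine (mixedNorm_mono fun x => eLpNorm_const_mul_le c _ _).trans ?_
    exact ih _

lemma exists_mixedNorm_add_le {n : ℕ} (V : Fin n → Submodule ℝ (Cd d)) (p : Fin n → ℝ≥0∞) :
    ∃ K : NNReal, ∀ f g : Cd d → ℝ≥0∞, Measurable f → Measurable g →
      mixedNorm n V p (fun z => f z + g z) ≤ K * (mixedNorm n V p f + mixedNorm n V p g) := by
  induction n with
  | zero => exact ⟨1, fun f g _ _ => by simp [mixedNorm]⟩
  | succ n ih =>
    obtain ⟨K, hK⟩ := ih (Fin.tail V) (Fin.tail p)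
    refine ⟨(p 0).LpAddConst.toNNReal * K, fun f g hf hg => ?_⟩
    have hfin : ((p 0).LpAddConst.toNNReal : ℝ≥0∞) = (p 0).LpAddConst :=
      ENNReal.coe_toNNReal (ENNReal.LpAddConst_lt_top _).ne
    have hF := measurable_eLpNorm_translate (V 0) hf (p 0)
    have hG := measurable_eLpNorm_translate (V 0) hg (p 0)
    simp only [mixedNorm]
    refine (mixedNorm_mono fun x => ?_).trans ((mixedNorm_const_mul_le (p 0).LpAddConst.toNNReal
      fun x => eLpNorm (fun y : V 0 => f (x + (y : Cd d))) (p 0) (lebesgue (V 0)) +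
        eLpNorm (fun y : V 0 => g (x + (y : Cd d))) (p 0) (lebesgue (V 0))).trans ?_)
    · rw [hfin]
      exact eLpNorm_add_le' (f := fun y : V 0 => f (x + (y : Cd d)))
        (g := fun y : V 0 => g (x + (y : Cd d))) (Measurable.aestronglyMeasurable (by fun_prop))
        (Measurable.aestronglyMeasurable (by fun_prop)) (p 0)
    · rw [ENNReal.coe_mul, mul_assoc]
      gcongr
      exact hK _ _ hF hG

lemma mixedNorm_mul_le {n : ℕ} {V : Fin n → Submodule ℝ (Cd d)} {p q r : Fin n → ℝ≥0∞}
    (hpqr : ∀ j, ENNReal.HolderTriple (p j) (q j) (r j)) {f g : Cd d → ℝ≥0∞}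
    (hf : Measurable f) (hg : Measurable g) :
    mixedNorm n V r (fun z => f z * g z) ≤ mixedNorm n V p f * mixedNorm n V q g := by
  induction n generalizing f g with
  | zero => simp [mixedNorm]
  | succ n ih =>
    have := hpqr 0
    refine (mixedNorm_mono fun x => eLpNorm_mul_le (p := p 0) (q := q 0) (r := r 0)
      (Measurable.aemeasurable (by fun_prop)) (Measurable.aemeasurable (by fun_prop))).trans ?_
    exact ih (fun j => hpqr j.succ) (measurable_eLpNorm_translate (V 0) hf (p 0))
      (measurable_eLpNorm_translate (V 0) hg (q 0))

lemma ae_lt_top_of_mixedNorm_lt_top {n : ℕ} {V : Fin n → Submodule ℝ (Cd d)} {p : Fin n → ℝ≥0∞}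
    (hp : ∀ j, p j ≠ 0) {f : Cd d → ℝ≥0∞} (hf : Measurable f) (h : mixedNorm n V p f < ∞) :
    ∀ᵐ z ∂mixedMeasure n V, f z < ∞ := by
  induction n generalizing f with
  | zero =>
    refine (ae_dirac_iff (measurableSet_lt hf measurable_const)).2 h
  | succ n ih =>
    refine ae_mixedMeasure_succ_of_ae_ae (measurableSet_lt hf measurable_const) ?_
    filter_upwards [ih (fun j => hp j.succ) (measurable_eLpNorm_translate (V 0) hf (p 0)) h]
      with x hx
    exact ae_lt_top_of_eLpNorm_lt_top (hp 0) (Measurable.aemeasurable (by fun_prop)) hx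

/-- Dominated convergence, one variable at a time. The inner norms are dominated by the inner norm
of `F`, which is finite for almost every outer point because the whole mixed norm of `F` is finite.
-/
lemma tendsto_mixedNorm_zero {n : ℕ} {V : Fin n → Submodule ℝ (Cd d)} {p : Fin n → ℝ≥0∞}
    (hp : ∀ j, p j ≠ 0) (hp' : ∀ j, p j ≠ ∞) {f : ℕ → Cd d → ℝ≥0∞} {F : Cd d → ℝ≥0∞}
    (hf : ∀ k, Measurable (f k)) (hFm : Measurable F)
    (hfF : ∀ k, ∀ᵐ z ∂mixedMeasure n V, f k z ≤ F z) (hF : mixedNorm n V p F < ∞)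
    (hlim : ∀ᵐ z ∂mixedMeasure n V, Tendsto (fun k => f k z) atTop (𝓝 0)) :
    Tendsto (fun k => mixedNorm n V p (f k)) atTop (𝓝 0) := by
  induction n generalizing f F with
  | zero =>
    have h : ∃ z : Cd d, z = 0 ∧ Tendsto (fun k => f k z) atTop (𝓝 0) := by
      by_contra! hc
      have h1 : Measure.dirac (0 : Cd d) {z | ¬ Tendsto (fun k => f k z) atTop (𝓝 0)} = 0 := hlim
      have h2 := Measure.dirac_apply_of_mem (a := (0 : Cd d))
        (s := {z | ¬ Tendsto (fun k => f k z) atTop (𝓝 0)}) (hc 0 rfl)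
      rw [h1] at h2
      simp at h2
    obtain ⟨z, rfl, hz⟩ := h
    exact hz
  | succ n ih =>
    have hFm' := measurable_eLpNorm_translate (V 0) hFm (p 0)
    refine ih (fun j => hp j.succ) (fun j => hp' j.succ)
      (fun k => measurable_eLpNorm_translate (V 0) (hf k) (p 0)) hFm' (fun k => ?_) hF ?_
    · filter_upwards [ae_mixedMeasure_succ (hfF k)] with x hx
      exact eLpNorm_mono_enorm_ae (by simpa using hx)
    · filter_upwards [ae_lt_top_of_mixedNorm_lt_top (fun j => hp j.succ) hFm' hF,
        ae_mixedMeasure_succ hlim, ae_all_iff.2 fun k => ae_mixedMeasure_succ (hfF k)]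
        with x hx hx2 hx3
      exact tendsto_eLpNorm_zero (hp 0) (hp' 0)
        (fun k => Measurable.aemeasurable (by fun_prop)) hx3 hx hx2

lemma mixedNorm_comp_smul_le {n : ℕ} (V : Fin n → Submodule ℝ (Cd d)) {p : Fin n → ℝ≥0∞} :
    ∃ K : NNReal, ∀ t : ℝ, 1 / 2 ≤ t → t ≤ 1 → ∀ f : Cd d → ℝ≥0∞,
      mixedNorm n V p (fun z => f (t • z)) ≤ K * mixedNorm n V p f := by
  induction n with
  | zero => exact ⟨1, fun t _ _ f => by simp [mixedNorm]⟩
  | succ n ih =>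
    obtain ⟨K, hK⟩ := ih (Fin.tail V) (p := Fin.tail p)
    set D := Module.finrank ℝ (V 0)
    -- Scaling by `t` in a space of dimension `D` multiplies the norm by `t ^ (-D / p)`, at most `2
    -- ^ (D / p)` for `t ≥ 1 / 2`. For an infinite exponent `(1 / p).toReal = 0` gives the correct
    -- factor 1.
    refine ⟨((ENNReal.ofReal (2 ^ D)) ^ (1 / p 0).toReal).toNNReal * K, fun t ht ht1 f => ?_⟩
    have ht0 : 0 < t := by linarith
    have hcoe : (((ENNReal.ofReal (2 ^ D)) ^ (1 / p 0).toReal).toNNReal : ℝ≥0∞)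
        = (ENNReal.ofReal (2 ^ D)) ^ (1 / p 0).toReal :=
      ENNReal.coe_toNNReal (ENNReal.rpow_ne_top_of_nonneg ENNReal.toReal_nonneg ENNReal.ofReal_ne_top)
    have key : ∀ g : V 0 → ℝ≥0∞, eLpNorm (fun y : V 0 => g (t • y)) (p 0) (lebesgue (V 0))
        ≤ (ENNReal.ofReal (2 ^ D)) ^ (1 / p 0).toReal * eLpNorm g (p 0) (lebesgue (V 0)) := by
      intro g
      have hm : MeasurableEmbedding fun y : V 0 => t • y :=
        (Homeomorph.smulOfNeZero t ht0.ne').measurableEmbedding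
      have h1 := hm.eLpNorm_map_measure (μ := lebesgue (V 0)) (g := g) (p := p 0)
      rw [Measure.map_addHaar_smul _ ht0.ne', eLpNorm_smul_measure_of_ne_zero
        (by rw [Ne, ENNReal.ofReal_eq_zero, not_le]; positivity)] at h1
      change eLpNorm (g ∘ fun y : V 0 => t • y) (p 0) (lebesgue (V 0)) ≤ _
      rw [← h1, smul_eq_mul]
      gcongr
      rw [abs_of_pos (by positivity), ← inv_pow]
      gcongr
      rw [inv_le_comm₀ ht0 two_pos]
      linarith
    rw [ENNReal.coe_mul, mul_assoc]
    simp only [mixedNorm]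
    refine (mixedNorm_mono fun x => ?_).trans ((mixedNorm_const_mul_le
      ((ENNReal.ofReal (2 ^ D)) ^ (1 / p 0).toReal).toNNReal
      (fun x => eLpNorm (fun y : V 0 => f (t • x + (y : Cd d))) (p 0) (lebesgue (V 0)))).trans ?_)
    · rw [hcoe]
      simpa [smul_add] using key fun y => f (t • x + (y : Cd d))
    · gcongr
      exact hK t ht ht1 fun x => eLpNorm (fun y : V 0 => f (x + (y : Cd d))) (p 0) (lebesgue (V 0))

/-- Integrating over `V 0` affects only the factor `h 0`, whose argument is merely translated. The
constant `c` is carried along so that the norm thus obtained can be absorbed into it in the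
induction. -/
lemma mixedNorm_prod {n : ℕ} {V : Fin n → Submodule ℝ (Cd d)} {p : Fin n → ℝ≥0∞}
    (π : (j : Fin n) → Cd d →ₗ[ℝ] V j) (h1 : ∀ j (v : V j), π j v = v)
    (h2 : ∀ i j, i ≠ j → ∀ v : V j, π i v = 0) (c : NNReal)
    (h : (j : Fin n) → V j → NNReal)
    (hfin : ∀ j, eLpNorm (fun y => (h j y : ℝ≥0∞)) (p j) (lebesgue (V j)) ≠ ∞) :
    mixedNorm n V p (fun z => c * ∏ j, (h j (π j z) : ℝ≥0∞))
      ≤ c * ∏ j, eLpNorm (fun y => (h j y : ℝ≥0∞)) (p j) (lebesgue (V j)) := by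
  induction n generalizing c with
  | zero => simp [mixedNorm]
  | succ n ih =>
    simp only [mixedNorm]
    rw [Fin.prod_univ_succ]
    have key : ∀ x : Cd d, eLpNorm (fun y : V 0 =>
        c * ∏ j, (h j (π j (x + (y : Cd d))) : ℝ≥0∞)) (p 0) (lebesgue (V 0)) ≤
        (c * ∏ j : Fin n, h j.succ (π j.succ x) : NNReal) *
          eLpNorm (fun y => (h 0 y : ℝ≥0∞)) (p 0) (lebesgue (V 0)) := by
      intro x
      have e1 : eLpNorm (fun y : V 0 => (h 0 (π 0 x + y) : ℝ≥0∞)) (p 0) (lebesgue (V 0))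
          = eLpNorm (fun y => (h 0 y : ℝ≥0∞)) (p 0) (lebesgue (V 0)) := by
        have hm : MeasurableEmbedding fun y : V 0 => π 0 x + y :=
          (Homeomorph.addLeft (π 0 x)).measurableEmbedding
        have := hm.eLpNorm_map_measure (μ := lebesgue (V 0))
          (g := fun y => (h 0 y : ℝ≥0∞)) (p := p 0)
        rw [map_add_left_eq_self] at this
        exact this.symm
      rw [← e1]
      refine le_of_eq_of_le ?_ (eLpNorm_const_mul_le _ _ _)
      congr 1
      funext y
      rw [Fin.prod_univ_succ]
      have : ∀ j : Fin n, π j.succ (x + (y : Cd d)) = π j.succ x := fun j => by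
        rw [map_add, h2 _ _ (Fin.succ_ne_zero j), add_zero]
      simp only [this, map_add, h1]
      push_cast
      ring
    refine (mixedNorm_mono key).trans ?_
    have htop := hfin 0
    lift eLpNorm (fun y => (h 0 y : ℝ≥0∞)) (p 0) (lebesgue (V 0)) to NNReal using htop with K
    have := ih (V := Fin.tail V) (p := Fin.tail p) (fun j => π j.succ) (fun j => h1 j.succ)
      (fun i j hij => h2 _ _ (by simpa using hij)) (c * K) (fun j => h j.succ)
      (fun j => hfin j.succ)
    refine le_trans (le_of_eq ?_) (this.trans (le_of_eq ?_))
    · congr 1; funext x; push_cast; exact mul_right_comm _ _ _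
    · push_cast; exact mul_assoc _ _ _

end Mixed

/-! ### Direct sums: Gaussians have finite mixed norm, and the iterated measure is a multiple of
Lebesgue measure -/

section Internal

variable {d : ℕ}

lemma eLpNorm_gaussian_ne_top (W : Submodule ℝ (Cd d)) {c : ℝ} (hc : 0 < c) (p : ℝ≥0∞) :
    eLpNorm (fun y : W => ENNReal.ofReal (Real.exp (-(c * ‖y‖ ^ 2)))) p (lebesgue W) ≠ ∞ := by
  rcases eq_or_ne p 0 with rfl | h0
  · simp
  rcases eq_or_ne p ∞ with rfl | htop
  · rw [eLpNorm_exponent_top]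
    refine (eLpNormEssSup_lt_top_of_ae_enorm_bound (C := 1) (.of_forall fun y => ?_)).ne
    simp only [enorm_eq_self, ENNReal.coe_one, ENNReal.ofReal_le_one, Real.exp_le_one_iff]
    have : 0 ≤ c * ‖y‖ ^ 2 := by positivity
    linarith
  have hr : 0 < p.toReal := ENNReal.toReal_pos h0 htop
  -- The power $(1+|y|)^{-m}$ is integrable as soon as `m` exceeds the dimension. It dominates the
  -- Gaussian through $(1+x)^m\le m!\,e^{1+x}$ and completion of the square in $1+x-bx^2$.
  set m := Module.finrank ℝ W + 1 with hm
  have hint : Integrable (fun y : W => (1 + ‖y‖) ^ (-(m : ℝ))) (lebesgue W) :=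
    integrable_one_add_norm (by rw [hm]; push_cast; linarith)
  set b := c * p.toReal with hb
  have hb0 : 0 < b := by positivity
  refine ((eLpNorm_lt_top_iff_lintegral_rpow_enorm_lt_top h0 htop).2 ?_).ne
  refine lt_of_le_of_lt (lintegral_mono fun y => ?_)
    (hint.const_mul (m.factorial * Real.exp (1 + 1 / (4 * b)))).lintegral_lt_top
  rw [enorm_eq_self, ENNReal.ofReal_rpow_of_pos (Real.exp_pos _)]
  refine ENNReal.ofReal_le_ofReal ?_
  have hx : 0 ≤ ‖y‖ := norm_nonneg y
  set x := ‖y‖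
  have h1 : (1 + x) ^ m ≤ m.factorial * Real.exp (1 + x) := by
    have := Real.pow_div_factorial_le_exp (1 + x) (by positivity) m
    rwa [div_le_iff₀' (by positivity)] at this
  have h2 : 1 + x - b * x ^ 2 ≤ 1 + 1 / (4 * b) := by
    have : 0 ≤ (2 * b * x - 1) ^ 2 / (4 * b) := by positivity
    have e : (2 * b * x - 1) ^ 2 / (4 * b) = b * x ^ 2 - x + 1 / (4 * b) := by
      field_simp; ring
    linarith
  rw [← Real.exp_mul, Real.rpow_neg (by positivity), Real.rpow_natCast, ← div_eq_mul_inv,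
    le_div_iff₀ (by positivity)]
  calc Real.exp (-(c * x ^ 2) * p.toReal) * (1 + x) ^ m
      ≤ Real.exp (-(b * x ^ 2)) * (m.factorial * Real.exp (1 + x)) := by
        rw [hb]
        have : -(c * x ^ 2) * p.toReal = -(c * p.toReal * x ^ 2) := by ring
        rw [this]
        gcongr
    _ = m.factorial * Real.exp (1 + x - b * x ^ 2) := by
        rw [mul_left_comm, ← Real.exp_add, neg_add_eq_sub]
    _ ≤ _ := by gcongr

/-- The projections of a direct sum onto its summands. -/
def internalProj {n : ℕ} {V : Fin n → Submodule ℝ (Cd d)} (h : DirectSum.IsInternal V)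
    (j : Fin n) : Cd d →ₗ[ℝ] V j :=
  DirectSum.component ℝ (Fin n) (fun i => V i) j ∘ₗ
    (LinearEquiv.ofBijective (DirectSum.coeLinearMap V) h).symm.toLinearMap

lemma internalProj_coe {n : ℕ} {V : Fin n → Submodule ℝ (Cd d)} (h : DirectSum.IsInternal V)
    (i j : Fin n) (v : V j) :
    internalProj h i (v : Cd d) = DirectSum.lof ℝ (Fin n) (fun i => V i) j v i := by
  have : (LinearEquiv.ofBijective (DirectSum.coeLinearMap V) h).symm (v : Cd d)
      = DirectSum.lof ℝ (Fin n) (fun i => V i) j v := by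
    rw [LinearEquiv.symm_apply_eq]
    exact (DirectSum.coeLinearMap_lof V j v).symm
  simp [internalProj, this, DirectSum.component]
  rfl

lemma mixedNorm_gaussian_lt_top {n : ℕ} {V : Fin n → Submodule ℝ (Cd d)}
    (hV : DirectSum.IsInternal V) (p : Fin n → ℝ≥0∞) {c : ℝ} (hc : 0 < c) :
    mixedNorm n V p (fun z => ENNReal.ofReal (Real.exp (-(c * ‖z‖ ^ 2)))) < ∞ := by
  have hbound : ∀ j, ∃ K : ℝ, 0 < K ∧ ∀ z, ‖internalProj hV j z‖ ≤ K * ‖z‖ := fun j => by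
    refine ⟨‖(internalProj hV j).toContinuousLinearMap‖ + 1, by positivity, fun z => ?_⟩
    refine ((internalProj hV j).toContinuousLinearMap.le_opNorm z).trans ?_
    gcongr; linarith
  choose K hK0 hK using hbound
  -- These rates make $\sum_j b_j|\pi_jz|^2\le c|z|^2$, so the Gaussian is at most a product of
  -- Gaussians in the components. The `n + 1` avoids division by zero when `n = 0`.
  set b : Fin n → ℝ := fun j => c / ((n + 1) * K j ^ 2) with hb
  have hb0 : ∀ j, 0 < b j := fun j => by have := hK0 j; positivity
  have key := mixedNorm_prod (p := p) (internalProj hV)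
    (fun j v => by rw [internalProj_coe]; simp [DirectSum.lof_apply])
    (fun i j hij v => by rw [internalProj_coe, DirectSum.lof_eq_of, DirectSum.of_eq_of_ne _ _ _ hij])
    1 (fun j y => (Real.exp (-(b j * ‖y‖ ^ 2))).toNNReal)
    (fun j => eLpNorm_gaussian_ne_top (V j) (hb0 j) (p j))
  refine lt_of_le_of_lt ((mixedNorm_mono fun z => ?_).trans key) ?_
  · rw [ENNReal.coe_one, one_mul]
    change _ ≤ ∏ j, ENNReal.ofReal (Real.exp (-(b j * ‖internalProj hV j z‖ ^ 2)))
    rw [← ENNReal.ofReal_prod_of_nonneg fun j _ => (Real.exp_pos _).le, ← Real.exp_sum]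
    refine ENNReal.ofReal_le_ofReal (Real.exp_le_exp.2 ?_)
    rw [Finset.sum_neg_distrib, neg_le_neg_iff]
    calc ∑ j, b j * ‖internalProj hV j z‖ ^ 2 ≤ ∑ j : Fin n, c / (n + 1) * ‖z‖ ^ 2 := by
          refine Finset.sum_le_sum fun j _ => ?_
          have h1 : ‖internalProj hV j z‖ ^ 2 ≤ (K j * ‖z‖) ^ 2 := by gcongr; exact hK j z
          calc b j * ‖internalProj hV j z‖ ^ 2 ≤ b j * (K j * ‖z‖) ^ 2 := by
                gcongr
            _ = _ := by have := (hK0 j).ne'; simp only [hb]; field_simp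
      _ = (n / (n + 1)) * (c * ‖z‖ ^ 2) := by simp; ring
      _ ≤ 1 * (c * ‖z‖ ^ 2) := by
          gcongr
          rw [div_le_one (by positivity)]; linarith
      _ = _ := one_mul _
  · rw [ENNReal.coe_one, one_mul]
    exact ENNReal.prod_lt_top fun j _ => (eLpNorm_gaussian_ne_top (V j) (hb0 j) (p j)).lt_top

lemma lintegral_mixedMeasure_add {n : ℕ} {V : Fin n → Submodule ℝ (Cd d)} {i : Fin n}
    {v : Cd d} (hv : v ∈ V i) {f : Cd d → ℝ≥0∞} (hf : Measurable f) :
    ∫⁻ z, f (v + z) ∂mixedMeasure n V = ∫⁻ z, f z ∂mixedMeasure n V := by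
  induction n generalizing f with
  | zero => exact i.elim0
  | succ n ih =>
    rw [lintegral_mixedMeasure_succ V hf, lintegral_mixedMeasure_succ V (by fun_prop)]
    have hm : Measurable fun x => ∫⁻ y : V 0, f (x + (y : Cd d)) ∂lebesgue (V 0) := by
      simpa [eLpNorm_one_eq_lintegral_enorm] using measurable_eLpNorm_translate (V 0) hf 1
    rcases Fin.eq_zero_or_eq_succ i with rfl | ⟨j, rfl⟩
    · refine lintegral_congr fun x => ?_
      have := lintegral_add_left_eq_self (μ := lebesgue (V 0))
        (fun y : V 0 => f (x + (y : Cd d))) ⟨v, hv⟩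
      rw [← this]
      refine lintegral_congr fun y => ?_
      congr 1
      simp only [Submodule.coe_add]
      abel
    · rw [← ih (V := Fin.tail V) (i := j) hv hm]
      simp only [add_assoc]

/-- Translations by vectors of a single `V i` preserve the iterated integral, and the `V i` span the
space. -/
lemma mixedMeasure_isAddLeftInvariant {n : ℕ} {V : Fin n → Submodule ℝ (Cd d)}
    (hV : DirectSum.IsInternal V) : (mixedMeasure n V).IsAddLeftInvariant := by
  have key : ∀ v : Cd d, ∀ f : Cd d → ℝ≥0∞, Measurable f →
      ∫⁻ z, f (v + z) ∂mixedMeasure n V = ∫⁻ z, f z ∂mixedMeasure n V := by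
    intro v
    have hv : v ∈ ⨆ i, V i := by rw [hV.submodule_iSup_eq_top]; trivial
    induction hv using Submodule.iSup_induction' with
    | mem i x hx => exact fun f hf => lintegral_mixedMeasure_add hx hf
    | zero => simp
    | add x y _ _ hx hy =>
      intro f hf
      rw [← hx f hf, ← hy (fun z => f (x + z)) (by fun_prop)]
      simp only [add_assoc]
  refine ⟨fun v => ?_⟩
  refine Measure.ext fun s hs => ?_
  rw [Measure.map_apply (by fun_prop) hs, ← lintegral_indicator_one hs,
    ← key v _ (measurable_one.indicator hs),
    ← lintegral_indicator_one (measurable_const_add v hs)]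
  rfl

/-- Uniqueness of Haar measure. Its use is twofold: Lebesgue null sets become negligible for mixed
norms, and Hölder's inequality for mixed norms yields bounds on Lebesgue integrals. -/
lemma exists_mixedMeasure_eq_smul {n : ℕ} {V : Fin n → Submodule ℝ (Cd d)}
    (hV : DirectSum.IsInternal V) :
    ∃ c : NNReal, c ≠ 0 ∧ mixedMeasure n V = c • (volume : Measure (Cd d)) := by
  have := mixedMeasure_isAddLeftInvariant hV
  have hfin : IsFiniteMeasureOnCompacts (mixedMeasure n V) := by
    refine ⟨fun K hK => ?_⟩
    obtain ⟨R, hR⟩ := hK.isBounded.exists_norm_le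
    -- Finiteness on compact sets: a Gaussian is bounded below on `K` and has finite iterated
    -- integral, so Markov's inequality bounds the measure of `K`.
    have hg := mixedNorm_gaussian_lt_top hV (fun _ => ENNReal.ofReal 1) one_pos
    rw [mixedNorm_const_exponent V one_pos (by fun_prop)] at hg
    simp only [ENNReal.rpow_one, one_div, inv_one] at hg
    have h1 : ENNReal.ofReal (Real.exp (-R ^ 2)) * mixedMeasure n V K ≤
        ∫⁻ z, ENNReal.ofReal (Real.exp (-(1 * ‖z‖ ^ 2))) ∂mixedMeasure n V := by
      refine le_trans ?_ (mul_meas_ge_le_lintegral₀ (by fun_prop)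
        (ENNReal.ofReal (Real.exp (-R ^ 2))))
      gcongr
      intro z hz
      refine ENNReal.ofReal_le_ofReal (Real.exp_le_exp.2 ?_)
      have := hR z hz
      have : ‖z‖ ^ 2 ≤ R ^ 2 := by gcongr
      linarith
    by_contra htop
    rw [not_lt, top_le_iff] at htop
    rw [htop, ENNReal.mul_top (by simp [Real.exp_pos])] at h1
    exact absurd hg (by simpa using h1)
  have h := Measure.isAddLeftInvariant_eq_smul (mixedMeasure n V) (volume : Measure (Cd d))
  refine ⟨_, ?_, h⟩
  intro h0
  rw [h0, zero_smul] at h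
  have hne : ∀ (n : ℕ) (V : Fin n → Submodule ℝ (Cd d)), mixedMeasure n V ≠ 0 := by
    intro n
    induction n with
    | zero => intro V; simp [mixedMeasure]
    | succ n ih =>
      intro V h0
      have h1 := lintegral_mixedMeasure_succ V (measurable_one)
      simp only [h0, Pi.one_apply, lintegral_one, lintegral_const] at h1
      have h2 : lebesgue (V 0) univ ≠ 0 := by simp [NeZero.ne]
      have h3 : mixedMeasure n (Fin.tail V) univ ≠ 0 := by simpa using ih (Fin.tail V)
      exact mul_ne_zero h2 h3 h1.symm
  exact hne n V h

lemma ae_mixedMeasure_of_ae {n : ℕ} {V : Fin n → Submodule ℝ (Cd d)}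
    (hV : DirectSum.IsInternal V) {P : Cd d → Prop} (h : ∀ᵐ z, P z) :
    ∀ᵐ z ∂mixedMeasure n V, P z := by
  obtain ⟨c, -, hc⟩ := exists_mixedMeasure_eq_smul hV
  rw [hc]
  exact Measure.ae_smul_measure h c

end Internal

/-! ### The quasi-norm of a mixed space on `[0, ∞]`-valued functions -/

namespace MixedSpace

variable {d : ℕ} (B : MixedSpace d)

/-- The quasi-norm of a `[0, ∞]`-valued function. -/
def enormM (f : Cd d → ℝ≥0∞) : ℝ≥0∞ := mixedNorm B.n B.V B.p f

variable {B}

lemma enormM_mono {f g : Cd d → ℝ≥0∞} (h : ∀ z, f z ≤ g z) : B.enormM f ≤ B.enormM g :=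
  mixedNorm_mono h

lemma enormM_congr_ae {f g : Cd d → ℝ≥0∞} (h : f =ᵐ[volume] g) : B.enormM f = B.enormM g :=
  le_antisymm (mixedNorm_mono_ae (ae_mixedMeasure_of_ae B.isInternal h.le))
    (mixedNorm_mono_ae (ae_mixedMeasure_of_ae B.isInternal h.symm.le))

lemma enormM_const_mul_le (c : NNReal) (f : Cd d → ℝ≥0∞) :
    B.enormM (fun z => c * f z) ≤ c * B.enormM f := mixedNorm_const_mul_le c f

lemma enormM_const_mul_le' {c : ℝ≥0∞} (hc : c ≠ ∞) (f : Cd d → ℝ≥0∞) :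
    B.enormM (fun z => c * f z) ≤ c * B.enormM f := by
  lift c to NNReal using hc
  exact enormM_const_mul_le c f

variable (B) in
lemma exists_enormM_add_le : ∃ K : NNReal, ∀ f g : Cd d → ℝ≥0∞, AEMeasurable f volume →
    AEMeasurable g volume → B.enormM (fun z => f z + g z) ≤ K * (B.enormM f + B.enormM g) := by
  obtain ⟨K, hK⟩ := exists_mixedNorm_add_le B.V B.p
  refine ⟨K, fun f g hf hg => ?_⟩
  rw [enormM_congr_ae hf.ae_eq_mk, enormM_congr_ae hg.ae_eq_mk,
    enormM_congr_ae (f := fun z => f z + g z) (hf.ae_eq_mk.add hg.ae_eq_mk)]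
  exact hK _ _ hf.measurable_mk hg.measurable_mk

variable (B) in
lemma exists_enormM_comp_smul_le : ∃ K : NNReal, ∀ t : ℝ, 1 / 2 ≤ t → t ≤ 1 →
    ∀ f : Cd d → ℝ≥0∞, B.enormM (fun z => f (t • z)) ≤ K * B.enormM f :=
  mixedNorm_comp_smul_le B.V

variable (B) in
lemma enormM_gaussian_lt_top {c : ℝ} (hc : 0 < c) :
    B.enormM (fun z => ENNReal.ofReal (Real.exp (-(c * ‖z‖ ^ 2)))) < ∞ :=
  mixedNorm_gaussian_lt_top B.isInternal B.p hc

/-- The part of a function of finite quasi-norm near infinity is small. -/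
lemma tendsto_enormM_tail (hB : B.nu2 < ∞) {f : Cd d → ℝ≥0∞} (hf : AEMeasurable f volume)
    (hfin : B.enormM f < ∞) :
    Tendsto (fun k : ℕ => B.enormM ({z | (k : ℝ) < ‖z‖}.indicator f)) atTop (𝓝 0) := by
  have hms : ∀ k : ℕ, MeasurableSet {z : Cd d | (k : ℝ) < ‖z‖} := fun k =>
    measurableSet_lt measurable_const measurable_norm
  have hcongr : ∀ k : ℕ, B.enormM ({z | (k : ℝ) < ‖z‖}.indicator f)
      = B.enormM ({z | (k : ℝ) < ‖z‖}.indicator (hf.mk f)) := fun k =>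
    enormM_congr_ae (hf.ae_eq_mk.mono fun z hz => by simp only [indicator, hz])
  simp_rw [hcongr]
  refine tendsto_mixedNorm_zero (fun j => (B.p_pos j).ne')
    (fun j => ((le_iSup B.p j).trans_lt hB).ne) (fun k => hf.measurable_mk.indicator (hms k))
    hf.measurable_mk (fun k => .of_forall fun z => indicator_le_self _ _ _)
    (by rwa [enormM_congr_ae hf.ae_eq_mk] at hfin) (.of_forall fun z => ?_)
  refine tendsto_const_nhds.congr' ?_
  obtain ⟨N, hN⟩ := exists_nat_ge ‖z‖
  filter_upwards [eventually_ge_atTop N] with k hk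
  rw [indicator_of_notMem]
  exact not_lt.2 (hN.trans (by exact_mod_cast hk))

/-- Hölder's inequality for an iterated quasi-norm against Lebesgue measure. -/
lemma exists_lintegral_rpow_le {q : Fin B.n → ℝ≥0∞} {r : ℝ} (hr : 0 < r)
    (hpq : ∀ j, ENNReal.HolderTriple (B.p j) (q j) (ENNReal.ofReal r)) :
    ∃ c : NNReal, ∀ f g : Cd d → ℝ≥0∞, AEMeasurable f volume → AEMeasurable g volume →
      ∫⁻ z, (f z * g z) ^ r ≤ c * (B.enormM f * mixedNorm B.n B.V q g) ^ r := by
  obtain ⟨c, hc, hcμ⟩ := exists_mixedMeasure_eq_smul B.isInternal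
  refine ⟨c⁻¹, fun f g hf hg => ?_⟩
  have hg' : mixedNorm B.n B.V q (hg.mk g) = mixedNorm B.n B.V q g :=
    le_antisymm (mixedNorm_mono_ae (ae_mixedMeasure_of_ae B.isInternal hg.ae_eq_mk.symm.le))
      (mixedNorm_mono_ae (ae_mixedMeasure_of_ae B.isInternal hg.ae_eq_mk.le))
  have h := mixedNorm_mul_le (V := B.V) hpq hf.measurable_mk hg.measurable_mk
  rw [mixedNorm_const_exponent B.V hr (f := fun z => hf.mk f z * hg.mk g z)
    (hf.measurable_mk.mul hg.measurable_mk), hg',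
    one_div, ENNReal.rpow_inv_le_iff hr, hcμ, lintegral_smul_measure] at h
  rw [enormM_congr_ae hf.ae_eq_mk]
  have h2 : ∫⁻ z, (f z * g z) ^ r = ∫⁻ z, (hf.mk f z * hg.mk g z) ^ r := by
    refine lintegral_congr_ae ?_
    filter_upwards [hf.ae_eq_mk, hg.ae_eq_mk] with z h1 h2
    rw [h1, h2]
  rw [h2, ENNReal.coe_inv hc]
  calc _ = (c : ℝ≥0∞)⁻¹ * (c * ∫⁻ z, (hf.mk f z * hg.mk g z) ^ r) := by
        rw [← mul_assoc, ENNReal.inv_mul_cancel (by simpa using hc) (by simp), one_mul]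
    _ ≤ _ := by gcongr; exact h

end MixedSpace

section Entire

/-! ### Entire functions: Taylor expansion along complex lines -/

/-- Differentiation under the integral sign. The derivative for `t` in the unit ball about `t₀` is
dominated by Cauchy's estimate on unit circles, which stay in the closed ball of radius 2. -/
lemma differentiable_intervalIntegral_param {Φ : ℂ → ℝ → ℂ} {a b : ℝ}
    (hc : Continuous (Function.uncurry Φ)) (hd : ∀ θ, Differentiable ℂ fun t => Φ t θ) :
    Differentiable ℂ fun t => ∫ θ in a..b, Φ t θ := by
  intro t₀
  obtain ⟨M, hM⟩ := ((isCompact_closedBall t₀ 2).prod (isCompact_uIcc (a := a) (b := b))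
    ).exists_bound_of_continuousOn hc.continuousOn
  have hcθ : ∀ t, Continuous (Φ t) := fun t =>
    hc.comp (continuous_const.prodMk continuous_id)
  have h := intervalIntegral.hasDerivAt_integral_of_dominated_loc_of_deriv_le (𝕜 := ℂ)
    (μ := volume) (a := a) (b := b) (F := Φ) (x₀ := t₀)
    (F' := fun t θ => deriv (fun s => Φ s θ) t) (bound := fun _ => M / 1)
    (Metric.ball_mem_nhds t₀ one_pos)
    (.of_forall fun t => (hcθ t).aestronglyMeasurable) ((hcθ t₀).intervalIntegrable _ _)
    ?_ ?_ intervalIntegrable_const ?_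
  · exact h.2.differentiableAt
  · have hc' : Continuous (Function.uncurry fun θ t => Φ t θ) := hc.comp continuous_swap
    exact ((stronglyMeasurable_deriv_with_param hc').comp_measurable
      (measurable_prodMk_right (y := t₀))).aestronglyMeasurable
  · refine .of_forall fun θ hθ t ht => ?_
    refine Complex.norm_deriv_le_of_forall_mem_sphere_norm_le one_pos
      (hd θ).diffContOnCl fun s hs => ?_
    refine hM (s, θ) ⟨?_, uIoc_subset_uIcc hθ⟩
    have h1 : dist s t = 1 := hs
    have h2 : dist t t₀ < 1 := ht
    have := dist_triangle s t t₀
    simp only [Metric.mem_closedBall]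
    linarith
  · exact .of_forall fun θ _ t _ => (hd θ t).hasDerivAt

/-- An entire function of polynomial growth is a polynomial. -/
lemma exists_polynomial_of_growth {g : ℂ → ℂ} (hg : Differentiable ℂ g) {k : ℕ} {C : ℝ}
    (hC : ∀ t, ‖g t‖ ≤ C * (1 + ‖t‖) ^ k) :
    ∃ P : Polynomial ℂ, P.degree < (k + 1 : ℕ) ∧ ∀ t, g t = P.eval t := by
  have hz : ∀ n, k < n → iteratedDeriv n g 0 = 0 := by
    intro n hn
    -- Cauchy's estimate on the circle of radius `R` gives $O(R^{k-n})$, at most $O(R^{-1})$ since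
    -- `n > k`.
    have hb : ∀ R : ℝ, 1 ≤ R → ‖iteratedDeriv n g 0‖ ≤ n.factorial * (C * 2 ^ k) * R⁻¹ := by
      intro R hR
      have hR0 : 0 < R := by linarith
      have hC0 : 0 ≤ C := by
        have := (norm_nonneg _).trans (hC 0)
        simpa using this
      refine (Complex.norm_iteratedDeriv_le_of_forall_mem_sphere_norm_le n hR0 hg.diffContOnCl
        (C := C * (2 * R) ^ k) fun z hz => (hC z).trans ?_).trans ?_
      · have : ‖z‖ = R := by simpa using hz
        gcongr
        linarith
      · rw [mul_pow, ← mul_assoc C, ← mul_assoc, mul_div_assoc]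
        gcongr
        rw [div_le_iff₀ (by positivity), inv_mul_eq_div, le_div_iff₀ hR0, ← pow_succ]
        exact pow_le_pow_right₀ hR hn
    have hlim : Tendsto (fun R : ℝ => n.factorial * (C * 2 ^ k) * R⁻¹) atTop (𝓝 0) := by
      simpa using tendsto_inv_atTop_zero.const_mul (n.factorial * (C * 2 ^ k))
    have := ge_of_tendsto hlim (eventually_ge_atTop 1 |>.mono hb)
    simpa using this
  refine ⟨∑ n ∈ Finset.range (k + 1),
    Polynomial.C ((n.factorial : ℂ)⁻¹ * iteratedDeriv n g 0) * Polynomial.X ^ n, ?_, fun t => ?_⟩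
  · refine (Polynomial.degree_lt_iff_coeff_zero _ _).2 fun m hm => ?_
    simp only [Polynomial.finsetSum_coeff, Polynomial.coeff_C_mul, Polynomial.coeff_X_pow]
    refine Finset.sum_eq_zero fun n hn => ?_
    have : m ≠ n := by have := Finset.mem_range.1 hn; omega
    simp [this]
  · have h := Complex.hasSum_taylorSeries_of_entire hg 0 t
    rw [← h.tsum_eq, tsum_eq_sum (s := Finset.range (k + 1)), Polynomial.eval_finsetSum]
    · refine Finset.sum_congr rfl fun n _ => ?_
      simp; ring
    · intro n hn
      rw [hz n (by simpa using hn)]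
      simp

variable {d : ℕ}

/-- A function on `ℂ^d` which is a polynomial of bounded degree in each variable separately is a
polynomial. -/
lemma exists_mvPolynomial_of_separately {k : ℕ} (S : Finset (Fin d)) (g : (Fin d → ℂ) → ℂ)
    (hg : ∀ z j, ∃ P : Polynomial ℂ, P.degree < (k + 1 : ℕ) ∧
      ∀ t, g (Function.update z j t) = P.eval t)
    (hS : ∀ z z', (∀ j ∈ S, z j = z' j) → g z = g z') :
    ∃ Q : MvPolynomial (Fin d) ℂ, ∀ z, g z = MvPolynomial.eval z Q := by
  induction S using Finset.induction_on generalizing g with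
  | empty => exact ⟨MvPolynomial.C (g 0), fun z => by simpa using hS z 0 (by simp)⟩
  | insert m S hm ih =>
    have hslice : ∀ x : ℂ, ∃ Q : MvPolynomial (Fin d) ℂ,
        ∀ z, g (Function.update z m x) = MvPolynomial.eval z Q := by
      intro x
      refine ih (fun z => g (Function.update z m x)) (fun z j => ?_) fun z z' hzz => ?_
      · rcases eq_or_ne j m with rfl | hjm
        · exact ⟨Polynomial.C (g (Function.update z j x)),
            Polynomial.degree_C_le.trans_lt (by exact_mod_cast Nat.succ_pos k), fun t => by simp⟩
        · simp only [Function.update_comm hjm]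
          exact hg _ j
      · refine hS _ _ fun j hj => ?_
        rcases eq_or_ne j m with rfl | hjm
        · simp
        · simpa [hjm] using hzz j (Finset.mem_of_mem_insert_of_ne hj hjm)
    choose Q hQ using hslice
    -- Lagrange interpolation in the variable `m` at the nodes `0, …, k`. Its coefficients are
    -- slices of `g` that no longer depend on variable `m`, hence polynomials by induction.
    set v : ℕ → ℂ := fun i => (i : ℂ) with hv
    have hinj : Set.InjOn v (Finset.range (k + 1) : Set ℕ) := fun a _ b _ h => by
      simpa [hv] using h
    refine ⟨∑ i ∈ Finset.range (k + 1),
      Q (v i) * Polynomial.aeval (MvPolynomial.X m) (Lagrange.basis (Finset.range (k + 1)) v i),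
      fun z => ?_⟩
    obtain ⟨P, hP, hPg⟩ := hg z m
    have h1 : g z = P.eval (z m) := by rw [← hPg, Function.update_eq_self]
    have hev : ∀ p : Polynomial ℂ, MvPolynomial.eval z (Polynomial.aeval (MvPolynomial.X m) p)
        = p.eval (z m) := fun p => by
      have := Polynomial.aeval_algHom_apply (MvPolynomial.aeval z) (MvPolynomial.X m) p
      simpa [MvPolynomial.aeval_eq_eval] using this.symm
    rw [h1, Lagrange.eq_interpolate (s := Finset.range (k + 1)) (f := P) hinj (by simpa using hP),
      Lagrange.interpolate_apply, Polynomial.eval_finsetSum, map_sum]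
    refine Finset.sum_congr rfl fun i _ => ?_
    rw [map_mul, ← hQ, hPg, Polynomial.eval_mul, Polynomial.eval_C, hev]

/-- The homogeneous part of degree `k` of an entire function. -/
def homogeneousPart (k : ℕ) (F : Cd d → ℂ) (z : Cd d) : ℂ :=
  (k.factorial : ℂ)⁻¹ * iteratedDeriv k (fun ζ : ℂ => F (ζ • z)) 0

lemma differentiable_comp_smul {F : Cd d → ℂ} (hF : Differentiable ℂ F) (z : Cd d) :
    Differentiable ℂ fun ζ : ℂ => F (ζ • z) := by fun_prop

lemma hasSum_homogeneousPart {F : Cd d → ℂ} (hF : Differentiable ℂ F) (z : Cd d) :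
    HasSum (fun k => homogeneousPart k F z) (F z) := by
  have := Complex.hasSum_taylorSeries_of_entire (differentiable_comp_smul hF z) 0 1
  simpa [homogeneousPart] using this

lemma norm_homogeneousPart_le {F : Cd d → ℂ} (hF : Differentiable ℂ F) (k : ℕ) (z : Cd d)
    {s M : ℝ} (hs : 0 < s) (hM : ∀ y, ‖y‖ ≤ s * ‖z‖ → ‖F y‖ ≤ M) :
    ‖homogeneousPart k F z‖ ≤ M / s ^ k := by
  have := Complex.norm_iteratedDeriv_le_of_forall_mem_sphere_norm_le (c := 0) k hs
    (differentiable_comp_smul hF z).diffContOnCl (C := M) fun ζ hζ => by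
      refine hM _ ?_
      have : ‖ζ‖ = s := by simpa using hζ
      rw [norm_smul, this]
  rw [homogeneousPart, norm_mul, norm_inv, Complex.norm_natCast,
    inv_mul_le_iff₀ (by positivity), ← mul_div_assoc]
  exact this

/-- Cauchy's formula turns the derivative at 0 into an integral of values of `F`, from which
holomorphy in `z` can be read off. -/
lemma homogeneousPart_eq_integral {F : Cd d → ℂ} (hF : Differentiable ℂ F) (k : ℕ) (z : Cd d) :
    homogeneousPart k F z = (2 * Real.pi * Complex.I)⁻¹ *
      ∫ θ in (0 : ℝ)..2 * Real.pi, deriv (circleMap 0 1) θ *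
        ((1 / circleMap 0 1 θ ^ (k + 1)) * F (circleMap 0 1 θ • z)) := by
  have h := DiffContOnCl.circleIntegral_one_div_sub_center_pow_smul (c := 0) one_pos k
    (differentiable_comp_smul hF z).diffContOnCl
  simp only [circleIntegral, sub_zero, smul_eq_mul] at h
  have hpi : (2 * Real.pi * Complex.I : ℂ) ≠ 0 := Complex.two_pi_I_ne_zero
  rw [h, homogeneousPart]
  field_simp

lemma differentiable_homogeneousPart_line {F : Cd d → ℂ} (hF : Differentiable ℂ F) (k : ℕ)
    (z v : Cd d) : Differentiable ℂ fun t : ℂ => homogeneousPart k F (z + t • v) := by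
  simp only [homogeneousPart_eq_integral hF]
  refine Differentiable.const_mul (differentiable_intervalIntegral_param ?_ fun θ => ?_) _
  · have h0 : ∀ θ, circleMap 0 1 θ ≠ 0 := fun θ => circleMap_ne_center one_ne_zero
    have := hF.continuous
    simp only [deriv_circleMap]
    unfold Function.uncurry
    have hcm : Continuous (circleMap 0 1) := continuous_circleMap 0 1
    refine Continuous.mul (by fun_prop) (Continuous.mul ?_ (by fun_prop))
    refine Continuous.div continuous_const (by fun_prop) fun x => pow_ne_zero _ (h0 _)
  · fun_prop

/-- Cauchy's estimate with radius $1/(1+|z|)$ bounds the part by $M(1+|z|)^k$. Being entire along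
lines, it is then a polynomial of degree at most `k` in each variable. -/
lemma homogeneousPart_mem_polynomials {F : Cd d → ℂ} (hF : Differentiable ℂ F) (k : ℕ) :
    homogeneousPart k F ∈ polynomials d := by
  obtain ⟨M, hM⟩ := (isCompact_closedBall (0 : Cd d) 1).exists_bound_of_continuousOn
    hF.continuous.continuousOn
  have hM0 : 0 ≤ M := (norm_nonneg _).trans (hM 0 (by simp))
  have hbound : ∀ z : Cd d, ‖homogeneousPart k F z‖ ≤ M * (1 + ‖z‖) ^ k := by
    intro z
    have hz : 0 < 1 + ‖z‖ := by positivity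
    refine (norm_homogeneousPart_le hF k z (inv_pos.2 hz) (M := M) fun y hy => hM y ?_).trans
      (le_of_eq (by rw [inv_pow, div_inv_eq_mul]))
    rw [mem_closedBall_zero_iff]
    refine hy.trans ?_
    rw [inv_mul_le_iff₀ hz]; linarith
  have hsep : ∀ (z : Fin d → ℂ) j, ∃ P : Polynomial ℂ, P.degree < (k + 1 : ℕ) ∧
      ∀ t, homogeneousPart k F (WithLp.toLp 2 (Function.update z j t)) = P.eval t := by
    intro z j
    set z₀ : Cd d := WithLp.toLp 2 (Function.update z j 0)
    set e : Cd d := EuclideanSpace.single j 1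
    have hline : ∀ t : ℂ, (WithLp.toLp 2 (Function.update z j t) : Cd d) = z₀ + t • e := by
      intro t
      ext i
      rcases eq_or_ne i j with rfl | hij
      · simp [z₀, e]
      · simp [z₀, e, hij]
    simp only [hline]
    refine exists_polynomial_of_growth (differentiable_homogeneousPart_line hF k z₀ e)
      (C := M * (1 + ‖z₀‖) ^ k) fun t => (hbound _).trans ?_
    rw [mul_assoc, ← mul_pow]
    gcongr
    have h1 : ‖z₀ + t • e‖ ≤ ‖z₀‖ + ‖t‖ := by
      refine (norm_add_le _ _).trans ?_
      rw [norm_smul]; simp [e]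
    nlinarith [norm_nonneg z₀, norm_nonneg t]
  obtain ⟨Q, hQ⟩ := exists_mvPolynomial_of_separately Finset.univ
    (fun z : Fin d → ℂ => homogeneousPart k F (WithLp.toLp 2 z)) hsep
    (fun z z' h => by rw [funext fun j => h j (Finset.mem_univ j)])
  exact ⟨Q, funext fun z => hQ _⟩

lemma sum_mem_polynomials {ι : Type*} (s : Finset ι) {F : ι → Cd d → ℂ}
    (hF : ∀ i ∈ s, F i ∈ polynomials d) : (fun z => ∑ i ∈ s, F i z) ∈ polynomials d := by
  choose! P hP using hF
  refine ⟨∑ i ∈ s, P i, funext fun z => ?_⟩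
  rw [map_sum]
  exact Finset.sum_congr rfl fun i hi => congrFun (hP i hi) z

/-- An entire function of Gaussian growth is approximated by polynomials in a slightly weaker
Gaussian norm. -/
lemma exists_polynomial_approx {F : Cd d → ℂ} (hF : Differentiable ℂ F) {κ κ' C : ℝ}
    (hκ0 : 0 < κ) (hκ : κ < κ') (hC : ∀ z, ‖F z‖ ≤ C * Real.exp (κ * ‖z‖ ^ 2)) {δ : ℝ} (hδ : 0 < δ) :
    ∃ P ∈ polynomials d, ∀ z, ‖P z - F z‖ ≤ δ * Real.exp (κ' * ‖z‖ ^ 2) := by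
  have hC0 : 0 ≤ C := by
    have := (norm_nonneg _).trans (hC 0)
    simpa using this
  -- With $\kappa s^2=\kappa'$, Cauchy's estimate at radius `s > 1` trades the growth $\kappa$ for
  -- $\kappa'$ and gains the geometric factor $s^{-k}$, uniformly in `z`.
  set s := Real.sqrt (κ' / κ) with hs
  have hs1 : 1 < s := by
    rw [hs, Real.lt_sqrt zero_le_one, one_pow, one_lt_div hκ0]; exact hκ
  have hs0 : 0 < s := by linarith
  have hs2 : κ * s ^ 2 = κ' := by
    rw [hs, Real.sq_sqrt (by have := hκ0.trans hκ; positivity)]; field_simp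
  have hbound : ∀ k z, ‖homogeneousPart k F z‖ ≤ C * Real.exp (κ' * ‖z‖ ^ 2) * (s⁻¹) ^ k := by
    intro k z
    refine (norm_homogeneousPart_le hF k z hs0 (M := C * Real.exp (κ' * ‖z‖ ^ 2))
      fun y hy => (hC y).trans ?_).trans (le_of_eq (by rw [inv_pow, div_eq_mul_inv]))
    refine mul_le_mul_of_nonneg_left (Real.exp_le_exp.2 ?_) hC0
    rw [← hs2, mul_assoc, ← mul_pow]
    exact mul_le_mul_of_nonneg_left (pow_le_pow_left₀ (norm_nonneg _) hy 2) hκ0.le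
  have hr1 : s⁻¹ < 1 := inv_lt_one_of_one_lt₀ hs1
  obtain ⟨N, hN⟩ : ∃ N : ℕ, C * (s⁻¹) ^ N / (1 - s⁻¹) < δ := by
    have : Tendsto (fun N : ℕ => C * (s⁻¹) ^ N / (1 - s⁻¹)) atTop (𝓝 0) := by
      simpa using ((tendsto_pow_atTop_nhds_zero_of_lt_one (by positivity) hr1).const_mul
        C).div_const (1 - s⁻¹)
    exact (this.eventually (gt_mem_nhds hδ)).exists
  refine ⟨_, sum_mem_polynomials (Finset.range N) fun k _ =>
    homogeneousPart_mem_polynomials hF k, fun z => ?_⟩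
  have h1 := norm_sub_le_of_geometric_bound_of_hasSum hr1 (hbound · z)
    (hasSum_homogeneousPart hF z) N
  refine h1.trans ?_
  have : C * Real.exp (κ' * ‖z‖ ^ 2) * s⁻¹ ^ N / (1 - s⁻¹)
    = (C * s⁻¹ ^ N / (1 - s⁻¹)) * Real.exp (κ' * ‖z‖ ^ 2) := by ring
  rw [this]
  gcongr

end Entire

section Submean

/-! ### Subharmonicity of `|F|^r` -/

/-- Jensen's formula: the average exceeds $\log|f(0)|$ by a sum over the zeros in the disc, each
contributing a non-negative amount. -/
lemma log_norm_le_circleAverage {f : ℂ → ℂ} (hf : Differentiable ℂ f) (h0 : f 0 ≠ 0) :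
    Real.log ‖f 0‖ ≤ Real.circleAverage (fun z => Real.log ‖f z‖) 0 1 := by
  have han : AnalyticOnNhd ℂ f (Metric.closedBall 0 |1|) := fun z _ => hf.analyticAt z
  rw [AnalyticOnNhd.circleAverage_log_norm one_ne_zero han h0]
  refine le_add_of_nonneg_left (finsum_nonneg fun u => ?_)
  by_cases hu : u ∈ Metric.closedBall (0 : ℂ) |1|
  · refine mul_nonneg (by exact_mod_cast MeromorphicOn.AnalyticOnNhd.divisor_nonneg han u) ?_
    have hu1 : ‖u‖ ≤ 1 := by simpa using hu
    rw [one_mul, zero_sub, norm_neg, Real.log_inv]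
    have := Real.log_nonpos (norm_nonneg u) hu1
    linarith
  · rw [Function.locallyFinsuppWithin.apply_eq_zero_of_notMem _ hu]
    simp

/-- The elementary bound $\log y\le y/e$ with $y=|g|^r$ turns subharmonicity of $\log|g|$ into an
inequality for $|g|^r$. Applied to a suitable multiple of `f` it loses nothing, because $\log y\le
y/e$ is an equality at $y=e$. -/
lemma norm_rpow_le_circleAverage {f : ℂ → ℂ} (hf : Differentiable ℂ f) {r : ℝ} (hr : 0 < r) :
    ‖f 0‖ ^ r ≤ Real.circleAverage (fun z => ‖f z‖ ^ r) 0 1 := by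
  have hcont : ∀ g : ℂ → ℂ, Differentiable ℂ g → CircleIntegrable (fun z => ‖g z‖ ^ r) 0 1 :=
    fun g hg => (Continuous.continuousOn
      (hg.continuous.norm.rpow_const fun _ => Or.inr hr.le)).circleIntegrable zero_le_one
  set A := Real.circleAverage (fun z => ‖f z‖ ^ r) 0 1 with hA
  have hA0 : 0 ≤ A := Real.circleAverage_nonneg_of_nonneg fun z _ => by positivity
  rcases eq_or_ne (f 0) 0 with h0 | h0
  · rwa [h0, norm_zero, Real.zero_rpow hr.ne']
  have key : ∀ g : ℂ → ℂ, Differentiable ℂ g → g 0 ≠ 0 →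
      r * Real.log ‖g 0‖ ≤ (Real.exp 1)⁻¹ * Real.circleAverage (fun z => ‖g z‖ ^ r) 0 1 := by
    intro g hg hg0
    calc r * Real.log ‖g 0‖ ≤ r * Real.circleAverage (fun z => Real.log ‖g z‖) 0 1 := by
          gcongr; exact log_norm_le_circleAverage hg hg0
      _ = Real.circleAverage (fun z => r • Real.log ‖g z‖) 0 1 := by
          rw [Real.circleAverage_fun_smul, smul_eq_mul]
      _ ≤ Real.circleAverage (fun z => (Real.exp 1)⁻¹ • ‖g z‖ ^ r) 0 1 := by
          refine Real.circleAverage_mono ?_ ((hcont g hg).const_smul) fun z _ => ?_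
          · exact (MeromorphicOn.circleIntegrable_log_norm
              fun z _ => (hg.analyticAt z).meromorphicAt).const_smul
          · rcases eq_or_ne (g z) 0 with hz | hz
            -- At a zero both sides vanish, thanks to the default value `Real.log 0 = 0`.
            · simp [hz, Real.zero_rpow hr.ne']
            · have hp : 0 < ‖g z‖ := norm_pos_iff.2 hz
              have := Real.log_le_sub_one_of_pos (x := ‖g z‖ ^ r / Real.exp 1) (by positivity)
              rw [Real.log_div (by positivity) (by positivity), Real.log_rpow hp, Real.log_exp,
                div_eq_inv_mul] at this
              simp only [smul_eq_mul]
              linarith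
      _ = _ := by rw [Real.circleAverage_fun_smul, smul_eq_mul]
  refine le_of_forall_gt_imp_ge_of_dense fun A' hA' => ?_
  have hA'0 : 0 < A' := hA0.trans_lt hA'
  -- Normalised so that $c^rA'=e$. Taking `A' > A` allows division even when the average `A` is
  -- zero.
  set c : ℝ := (Real.exp 1 / A') ^ (1 / r) with hc
  have hc0 : 0 < c := by positivity
  have hcr : c ^ r = Real.exp 1 / A' := by
    rw [hc, ← Real.rpow_mul (by positivity), one_div_mul_cancel hr.ne', Real.rpow_one]
  have hnorm : ∀ z, ‖(c : ℂ) * f z‖ ^ r = c ^ r * ‖f z‖ ^ r := fun z => by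
    rw [norm_mul, Complex.norm_real, Real.norm_of_nonneg hc0.le,
      Real.mul_rpow hc0.le (norm_nonneg _)]
  have h := key (fun z => c * f z) (hf.const_mul _) (by simp [h0, hc0.ne'])
  have hpos : 0 < ‖(c : ℂ) * f 0‖ := norm_pos_iff.2 (by simp [h0, hc0.ne'])
  simp only [hnorm] at h
  have hsm := Real.circleAverage_fun_smul (c := 0) (R := 1) (a := c ^ r) (f := fun z => ‖f z‖ ^ r)
  simp only [smul_eq_mul] at hsm
  rw [hsm, ← Real.log_rpow hpos, hnorm, hcr, ← hA] at h
  have h1 : Real.log (Real.exp 1 / A' * ‖f 0‖ ^ r) ≤ 1 := by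
    refine h.trans ?_
    have e : (Real.exp 1)⁻¹ * (Real.exp 1 / A' * A) = A / A' := by
      field_simp
    rw [e, div_le_one hA'0]
    exact hA'.le
  have hpos2 : 0 < ‖f 0‖ ^ r := Real.rpow_pos_of_pos (norm_pos_iff.2 h0) _
  rw [Real.log_le_iff_le_exp (by positivity), div_mul_eq_mul_div, div_le_iff₀ hA'0] at h1
  exact le_of_mul_le_mul_left h1 (Real.exp_pos 1)

variable {d : ℕ}

/-- Multiplication by a complex number of modulus one. -/
def rotation (ζ : ℂ) (hζ : ‖ζ‖ = 1) : Cd d ≃ₗᵢ[ℝ] Cd d where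
  toLinearEquiv := (LinearEquiv.smulOfNeZero ℂ (Cd d) ζ
    (norm_pos_iff.1 (by rw [hζ]; exact one_pos))).restrictScalars ℝ
  norm_map' z := by
    change ‖ζ • z‖ = ‖z‖
    rw [norm_smul, hζ, one_mul]

lemma setLIntegral_ball_rotation {ζ : ℂ} (hζ : ‖ζ‖ = 1) (g : Cd d → ℝ≥0∞) :
    ∫⁻ z in Metric.ball 0 1, g (ζ • z) = ∫⁻ z in Metric.ball 0 1, g z := by
  have h := (rotation (d := d) ζ hζ).measurePreserving.setLIntegral_comp_preimage_emb
    (rotation (d := d) ζ hζ).toHomeomorph.measurableEmbedding g (Metric.ball 0 1)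
  rw [← h]
  have : (rotation (d := d) ζ hζ) ⁻¹' Metric.ball 0 1 = Metric.ball 0 1 := by
    ext z; simp
  rw [this]
  rfl

/-- The circle inequality on every complex line through `w` is integrated over directions `z` in the
ball. After exchanging the integrals the angle disappears, since the ball and its volume are
invariant under multiplication by $e^{i\theta}$. -/
lemma ofReal_norm_rpow_mul_volume_le {F : Cd d → ℂ} (hF : Differentiable ℂ F) {r : ℝ} (hr : 0 < r)
    (w : Cd d) :
    ENNReal.ofReal (‖F w‖ ^ r) * volume (Metric.ball (0 : Cd d) 1) ≤
      ∫⁻ z in Metric.ball (0 : Cd d) 1, ENNReal.ofReal (‖F (w + z)‖ ^ r) := by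
  have hpi : (0 : ℝ) < 2 * Real.pi := Real.two_pi_pos
  have hcont := hF.continuous
  have hcm : Continuous (circleMap 0 1) := continuous_circleMap 0 1
  have hline : ∀ z, ENNReal.ofReal (2 * Real.pi) * ENNReal.ofReal (‖F w‖ ^ r) ≤
      ∫⁻ θ in Ioc 0 (2 * Real.pi), ENNReal.ofReal (‖F (w + circleMap 0 1 θ • z)‖ ^ r) := by
    intro z
    have h := norm_rpow_le_circleAverage (f := fun ζ : ℂ => F (w + ζ • z)) (by fun_prop) hr
    rw [Real.circleAverage_def, smul_eq_mul, le_inv_mul_iff₀ hpi, zero_smul, add_zero,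
      intervalIntegral.integral_of_le hpi.le] at h
    rw [← ENNReal.ofReal_mul hpi.le, ← ofReal_integral_eq_lintegral_ofReal]
    · exact ENNReal.ofReal_le_ofReal h
    · refine (Continuous.integrableOn_Ioc ?_)
      exact (by fun_prop : Continuous fun θ => ‖F (w + circleMap 0 1 θ • z)‖).rpow_const
        fun _ => Or.inr hr.le
    · exact .of_forall fun θ => by positivity
  have hmeas : Measurable fun p : Cd d × ℝ =>
      ENNReal.ofReal (‖F (w + circleMap 0 1 p.2 • p.1)‖ ^ r) := by
    have : Continuous fun p : Cd d × ℝ => ‖F (w + circleMap 0 1 p.2 • p.1)‖ := by fun_prop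
    exact (this.measurable.pow_const r).ennreal_ofReal
  have key : ENNReal.ofReal (2 * Real.pi) * (ENNReal.ofReal (‖F w‖ ^ r) *
      volume (Metric.ball (0 : Cd d) 1)) ≤ ENNReal.ofReal (2 * Real.pi) *
        ∫⁻ z in Metric.ball (0 : Cd d) 1, ENNReal.ofReal (‖F (w + z)‖ ^ r) := by
    calc _ = ∫⁻ _ in Metric.ball (0 : Cd d) 1,
          ENNReal.ofReal (2 * Real.pi) * ENNReal.ofReal (‖F w‖ ^ r) := by
          rw [setLIntegral_const, mul_assoc]
      _ ≤ ∫⁻ z in Metric.ball (0 : Cd d) 1, ∫⁻ θ in Ioc 0 (2 * Real.pi),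
          ENNReal.ofReal (‖F (w + circleMap 0 1 θ • z)‖ ^ r) := lintegral_mono fun z => hline z
      _ = ∫⁻ θ in Ioc 0 (2 * Real.pi), ∫⁻ z in Metric.ball (0 : Cd d) 1,
          ENNReal.ofReal (‖F (w + circleMap 0 1 θ • z)‖ ^ r) :=
          lintegral_lintegral_swap hmeas.aemeasurable
      _ = ∫⁻ _ in Ioc 0 (2 * Real.pi), ∫⁻ z in Metric.ball (0 : Cd d) 1,
          ENNReal.ofReal (‖F (w + z)‖ ^ r) := lintegral_congr fun θ =>
          setLIntegral_ball_rotation (by simp)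
            fun z => ENNReal.ofReal (‖F (w + z)‖ ^ r)
      _ = _ := by rw [setLIntegral_const, Real.volume_Ioc, sub_zero, mul_comm]
  exact (ENNReal.mul_le_mul_iff_right (by simpa using Real.pi_pos) ENNReal.ofReal_ne_top).1 key

/-- Pointwise Gaussian growth from an integrated bound. -/
lemma exists_growth_of_lintegral {F : Cd d → ℂ} (hF : Differentiable ℂ F) {r a b : ℝ} (hr : 0 < r)
    (hb : 0 < b) (hab : b < a)
    (hI : ∫⁻ z, ENNReal.ofReal (‖F z‖ * Real.exp (-(b * ‖z‖ ^ 2))) ^ r < ∞) :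
    ∃ C : ℝ, ∀ w, ‖F w‖ ≤ C * Real.exp (a * ‖w‖ ^ 2) := by
  set I := ∫⁻ z, ENNReal.ofReal (‖F z‖ * Real.exp (-(b * ‖z‖ ^ 2))) ^ r with hIdef
  set v := volume (Metric.ball (0 : Cd d) 1) with hv
  have hv0 : v ≠ 0 := (Metric.measure_ball_pos _ _ one_pos).ne'
  have hv1 : v ≠ ∞ := measure_ball_lt_top.ne
  -- Completing the square gives $b(|w|+1)^2\le a|w|^2+c_1$; this is where `b < a` enters.
  set c₁ := b + b ^ 2 / (a - b) with hc₁
  have hquad : ∀ w z : Cd d, ‖z‖ < 1 → b * ‖w + z‖ ^ 2 ≤ a * ‖w‖ ^ 2 + c₁ := by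
    intro w z hz
    have h1 : ‖w + z‖ ≤ ‖w‖ + 1 := (norm_add_le _ _).trans (by linarith)
    have h2 : ‖w + z‖ ^ 2 ≤ (‖w‖ + 1) ^ 2 := by gcongr
    have hab' : 0 < a - b := by linarith
    have h3 : 0 ≤ ((a - b) * ‖w‖ - b) ^ 2 / (a - b) := by positivity
    have h4 : ((a - b) * ‖w‖ - b) ^ 2 / (a - b)
        = (a - b) * ‖w‖ ^ 2 - 2 * b * ‖w‖ + b ^ 2 / (a - b) := by
      field_simp; ring
    nlinarith
  have hmain : ∀ w, ENNReal.ofReal (‖F w‖ ^ r) * v ≤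
      ENNReal.ofReal (Real.exp (a * ‖w‖ ^ 2 + c₁) ^ r) * I := by
    intro w
    refine (ofReal_norm_rpow_mul_volume_le hF hr w).trans ?_
    calc _ ≤ ∫⁻ z in Metric.ball (0 : Cd d) 1, ENNReal.ofReal (Real.exp (a * ‖w‖ ^ 2 + c₁) ^ r) *
          ENNReal.ofReal (‖F (w + z)‖ * Real.exp (-(b * ‖w + z‖ ^ 2))) ^ r := by
          refine setLIntegral_mono' measurableSet_ball fun z hz => ?_
          rw [ENNReal.ofReal_rpow_of_nonneg (by positivity) hr.le,
            ← ENNReal.ofReal_mul (by positivity),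
            ← Real.mul_rpow (by positivity) (by positivity)]
          refine ENNReal.ofReal_le_ofReal (Real.rpow_le_rpow (norm_nonneg _) ?_ hr.le)
          have := hquad w z (by simpa using hz)
          rw [mul_left_comm, ← Real.exp_add]
          refine le_mul_of_one_le_right (norm_nonneg _) (Real.one_le_exp ?_)
          linarith
      _ ≤ ∫⁻ z, ENNReal.ofReal (Real.exp (a * ‖w‖ ^ 2 + c₁) ^ r) *
          ENNReal.ofReal (‖F (w + z)‖ * Real.exp (-(b * ‖w + z‖ ^ 2))) ^ r :=
          setLIntegral_le_lintegral _ _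
      _ = _ := by
          rw [lintegral_const_mul' _ _ ENNReal.ofReal_ne_top, lintegral_add_left_eq_self
            (fun z => ENNReal.ofReal (‖F z‖ * Real.exp (-(b * ‖z‖ ^ 2))) ^ r) w]
  have hIv : I / v ≠ ∞ := ENNReal.div_ne_top hI.ne hv0
  refine ⟨Real.exp c₁ * (I / v).toReal ^ (1 / r), fun w => ?_⟩
  have h1 : ENNReal.ofReal (‖F w‖ ^ r) ≤
      ENNReal.ofReal (Real.exp (a * ‖w‖ ^ 2 + c₁) ^ r * (I / v).toReal) := by
    rw [ENNReal.ofReal_mul (by positivity), ENNReal.ofReal_toReal hIv, ← mul_div_assoc,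
      ENNReal.le_div_iff_mul_le (Or.inl hv0) (Or.inl hv1)]
    exact hmain w
  rw [ENNReal.ofReal_le_ofReal_iff (by positivity)] at h1
  have h2 := Real.rpow_le_rpow (by positivity) h1 (one_div_nonneg.2 hr.le)
  rw [Real.mul_rpow (by positivity) ENNReal.toReal_nonneg, ← Real.rpow_mul (norm_nonneg _),
    ← Real.rpow_mul (Real.exp_pos _).le, mul_one_div_cancel hr.ne', Real.rpow_one,
    Real.rpow_one, Real.exp_add] at h2
  linarith

end Submean

section WeightedModulus

variable {d : ℕ}

/-! ### The weighted modulus of an entire function -/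

/-- Componentwise conjugation as a real linear isometry. -/
def conjIsometry : Cd d ≃ₗᵢ[ℝ] Cd d where
  toFun := conjVec
  invFun := conjVec
  map_add' x y := by ext j; simp [conjVec]
  map_smul' t x := by ext j; simp [conjVec]
  left_inv x := by ext j; simp [conjVec]
  right_inv x := by ext j; simp [conjVec]
  norm_map' x := by simp [conjVec, EuclideanSpace.norm_eq]

/-- The argument `2^{-1/2} \bar z` at which `U⁻¹` evaluates an entire function. -/
def bargmannArg (z : Cd d) : Cd d := (Real.sqrt 2)⁻¹ • conjVec z

lemma continuous_bargmannArg : Continuous (bargmannArg : Cd d → Cd d) :=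
  (conjIsometry (d := d)).continuous.fun_const_smul (Real.sqrt 2)⁻¹

lemma bargmannArg_smul (t : ℝ) (z : Cd d) : bargmannArg (t • z) = t • bargmannArg z := by
  have : conjVec (t • z) = t • conjVec z := (conjIsometry (d := d)).map_smul t z
  rw [bargmannArg, this, smul_comm]
  rfl

lemma norm_bargmannArg_sq (z : Cd d) : ‖bargmannArg z‖ ^ 2 = ‖z‖ ^ 2 / 2 := by
  have : ‖conjVec z‖ = ‖z‖ := (conjIsometry (d := d)).norm_map z
  rw [bargmannArg, norm_smul, this, mul_pow, norm_inv, Real.norm_of_nonneg (Real.sqrt_nonneg 2),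
    inv_pow, Real.sq_sqrt zero_le_two]
  ring

lemma exists_lintegral_comp_bargmannArg (d : ℕ) : ∃ c : NNReal, c ≠ 0 ∧
    ∀ g : Cd d → ℝ≥0∞, Measurable g → ∫⁻ z, g (bargmannArg z) = c * ∫⁻ z, g z := by
  have hs : (Real.sqrt 2)⁻¹ ≠ 0 := by positivity
  set N := Module.finrank ℝ (Cd d)
  refine ⟨(|((Real.sqrt 2)⁻¹ ^ N)⁻¹|).toNNReal, ?_, fun g hg => ?_⟩
  · rw [Ne, Real.toNNReal_eq_zero, not_le]; positivity
  · calc ∫⁻ z, g (bargmannArg z) = ∫⁻ z : Cd d, g ((Real.sqrt 2)⁻¹ • z) :=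
          (conjIsometry (d := d)).measurePreserving.lintegral_comp
            (f := fun z => g ((Real.sqrt 2)⁻¹ • z)) (by fun_prop)
      _ = ∫⁻ z, g z ∂(Measure.map (fun z : Cd d => (Real.sqrt 2)⁻¹ • z) volume) :=
          (lintegral_map hg (by fun_prop)).symm
      _ = _ := by
          rw [Measure.map_addHaar_smul _ hs, lintegral_smul_measure]; rfl

/-- The modulus of `(U⁻¹ F) ω`. -/
def weightedModulus (ω : Cd d → ℝ) (F : Cd d → ℂ) (z : Cd d) : ℝ :=
  (2 * Real.pi) ^ (-(d : ℝ) / 2) * Real.exp (-(‖z‖ ^ 2 / 4)) * ‖F (bargmannArg z)‖ * ω z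

/-- The modulus of `(U⁻¹ F) ω` as a `[0, ∞]`-valued function. -/
def eModulus (ω : Cd d → ℝ) (F : Cd d → ℂ) (z : Cd d) : ℝ≥0∞ :=
  ENNReal.ofReal (weightedModulus ω F z)

/-- The exponent of the oscillating factor is purely imaginary, so that factor has modulus one. -/
lemma normA_eq {ω : Cd d → ℝ} (hω : ∀ z, 0 < ω z) (B : MixedSpace d) (F : Cd d → ℂ) :
    normA ω B F = B.enormM (eModulus ω F) := by
  unfold normA MixedSpace.qnorm MixedSpace.enormM
  congr 1
  funext z
  simp only [eModulus, weightedModulus, bargmannInv]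
  rw [← ofReal_norm, norm_mul, norm_mul, norm_mul,
    Complex.norm_real, Complex.norm_real, Real.norm_of_nonneg (hω z).le,
    Real.norm_of_nonneg (by positivity), Complex.norm_exp]
  have : (-(Complex.I * ((∑ j, (z j).re * (z j).im : ℝ) : ℂ) / 2)).re = 0 := by
    simp [Complex.neg_re, Complex.div_ofNat_re]
  rw [this, Real.exp_zero, mul_one]
  rfl

lemma aemeasurable_eModulus {ω : Cd d → ℝ} (hω : AEMeasurable ω volume) {F : Cd d → ℂ}
    (hF : Continuous F) : AEMeasurable (eModulus ω F) volume := by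
  have h : Continuous fun z : Cd d => (2 * Real.pi) ^ (-(d : ℝ) / 2) *
      Real.exp (-(‖z‖ ^ 2 / 4)) * ‖F (bargmannArg z)‖ := by
    have := hF.comp continuous_bargmannArg
    exact Continuous.mul (by fun_prop) this.norm
  exact (h.measurable.aemeasurable.mul hω).ennreal_ofReal

lemma eModulus_le_mul {ω : Cd d → ℝ} (hω : ∀ z, 0 < ω z) {F G : Cd d → ℂ} {z : Cd d} {c : ℝ}
    (hc : 0 ≤ c) (h : ‖F (bargmannArg z)‖ ≤ c * ‖G (bargmannArg z)‖) :
    eModulus ω F z ≤ ENNReal.ofReal c * eModulus ω G z := by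
  rw [eModulus, eModulus, ← ENNReal.ofReal_mul hc]
  refine ENNReal.ofReal_le_ofReal ?_
  have h1 := (hω z).le
  rw [weightedModulus, weightedModulus]
  calc _ ≤ (2 * Real.pi) ^ (-(d : ℝ) / 2) * Real.exp (-(‖z‖ ^ 2 / 4)) *
        (c * ‖G (bargmannArg z)‖) * ω z := by gcongr
    _ = _ := by ring

lemma eModulus_add_le {ω : Cd d → ℝ} (hω : ∀ z, 0 < ω z) (F G : Cd d → ℂ) (z : Cd d) :
    eModulus ω (F + G) z ≤ eModulus ω F z + eModulus ω G z := by
  have h1 := (hω z).le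
  rw [eModulus, eModulus, eModulus, ← ENNReal.ofReal_add (by unfold weightedModulus; positivity)
    (by unfold weightedModulus; positivity)]
  refine ENNReal.ofReal_le_ofReal ?_
  rw [weightedModulus, weightedModulus, weightedModulus, ← add_mul, ← mul_add]
  gcongr
  exact norm_add_le _ _

lemma eModulus_sub_le {ω : Cd d → ℝ} (hω : ∀ z, 0 < ω z) (F G : Cd d → ℂ) (z : Cd d) :
    eModulus ω (F - G) z ≤ eModulus ω F z + eModulus ω G z := by
  have h := eModulus_add_le hω F (-G) z
  have : eModulus ω (-G) z = eModulus ω G z := by simp [eModulus, weightedModulus]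
  rwa [this, ← sub_eq_add_neg] at h

lemma exists_normA_add_le {ω : Cd d → ℝ} (hω : ∀ z, 0 < ω z) (hm : AEMeasurable ω volume)
    (B : MixedSpace d) : ∃ K : NNReal, ∀ F G : Cd d → ℂ, Continuous F → Continuous G →
      normA ω B (F + G) ≤ K * (normA ω B F + normA ω B G) := by
  obtain ⟨K, hK⟩ := B.exists_enormM_add_le
  refine ⟨K, fun F G hF hG => ?_⟩
  simp only [normA_eq hω]
  exact (MixedSpace.enormM_mono fun z => eModulus_add_le hω F G z).trans
    (hK _ _ (aemeasurable_eModulus hm hF) (aemeasurable_eModulus hm hG))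

lemma exists_normA_sub_le {ω : Cd d → ℝ} (hω : ∀ z, 0 < ω z) (hm : AEMeasurable ω volume)
    (B : MixedSpace d) : ∃ K : NNReal, ∀ F G : Cd d → ℂ, Continuous F → Continuous G →
      normA ω B (F - G) ≤ K * (normA ω B F + normA ω B G) := by
  obtain ⟨K, hK⟩ := B.exists_enormM_add_le
  refine ⟨K, fun F G hF hG => ?_⟩
  simp only [normA_eq hω]
  exact (MixedSpace.enormM_mono fun z => eModulus_sub_le hω F G z).trans
    (hK _ _ (aemeasurable_eModulus hm hF) (aemeasurable_eModulus hm hG))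

/-! ### Gaussian bounds and the spaces `A(ω, ℬ)` -/

/-- The evaluation point has squared norm $|z|^2/2$, so $e^{\kappa|\cdot|^2}$ meets $e^{-|z|^2/4}$
as $e^{\kappa|z|^2/2}$, and $\kappa<1/2$ leaves decay at rate $1/4-\kappa/2=2c$. One `c` pays for
the weight, the other makes the mixed norm finite. -/
lemma exists_normA_le_of_gaussian {ω : Cd d → ℝ} (hω : IsWeaklySubgaussian ω) (B : MixedSpace d)
    {κ : ℝ} (hκ : κ < 1 / 2) : ∃ K : NNReal, ∀ (F : Cd d → ℂ) (C : ℝ), 0 ≤ C →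
      (∀ z, ‖F z‖ ≤ C * Real.exp (κ * ‖z‖ ^ 2)) → normA ω B F ≤ ENNReal.ofReal C * K := by
  set c := (1 / 4 - κ / 2) / 2 with hc
  have hc0 : 0 < c := by rw [hc]; linarith
  obtain ⟨C₀, hC₀, hbd⟩ := hω.subgaussian c hc0
  set c₁ : ℝ := (2 * Real.pi) ^ (-(d : ℝ) / 2) with hc₁
  have hc₁0 : 0 < c₁ := by positivity
  have hfin := (B.enormM_gaussian_lt_top hc0).ne
  refine ⟨(c₁ * C₀).toNNReal * (B.enormM fun z =>
    ENNReal.ofReal (Real.exp (-(c * ‖z‖ ^ 2)))).toNNReal, fun F C hC hF => ?_⟩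
  rw [normA_eq hω.isWeight.pos, ENNReal.coe_mul, ENNReal.coe_toNNReal hfin, ← mul_assoc]
  change _ ≤ ENNReal.ofReal C * ENNReal.ofReal (c₁ * C₀) * _
  rw [← ENNReal.ofReal_mul hC]
  refine (MixedSpace.enormM_mono fun z => ?_).trans
    (MixedSpace.enormM_const_mul_le' ENNReal.ofReal_ne_top _)
  rw [← ENNReal.ofReal_mul (by positivity)]
  refine ENNReal.ofReal_le_ofReal ?_
  have h1 := hF (bargmannArg z)
  rw [norm_bargmannArg_sq] at h1
  have h2 := (hω.isWeight.pos z).le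
  calc weightedModulus ω F z ≤ c₁ * Real.exp (-(‖z‖ ^ 2 / 4)) *
        (C * Real.exp (κ * (‖z‖ ^ 2 / 2))) * (C₀ * Real.exp (c * ‖z‖ ^ 2)) := by
        rw [weightedModulus]
        gcongr
        exact (hbd z).2
    _ = C * (c₁ * C₀) * (Real.exp (-(‖z‖ ^ 2 / 4)) * Real.exp (κ * (‖z‖ ^ 2 / 2)) *
        Real.exp (c * ‖z‖ ^ 2)) := by ring
    _ = _ := by
        rw [← Real.exp_add, ← Real.exp_add]
        congr 2
        rw [hc]; ring

lemma exists_gaussian_bound_of_mem_polynomials {F : Cd d → ℂ} (hF : F ∈ polynomials d) :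
    Differentiable ℂ F ∧
      ∀ κ > 0, ∃ C : ℝ, 0 ≤ C ∧ ∀ z, ‖F z‖ ≤ C * Real.exp (κ * ‖z‖ ^ 2) := by
  obtain ⟨P, rfl⟩ := hF
  induction P using MvPolynomial.induction_on with
  | C a =>
    refine ⟨by simp, fun κ hκ => ⟨‖a‖, norm_nonneg _, fun z => ?_⟩⟩
    simp only [MvPolynomial.eval_C]
    exact le_mul_of_one_le_right (norm_nonneg _) (Real.one_le_exp (by positivity))
  | add P Q hP hQ =>
    refine ⟨by simpa using hP.1.fun_add hQ.1, fun κ hκ => ?_⟩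
    obtain ⟨C, hC, h⟩ := hP.2 κ hκ
    obtain ⟨C', hC', h'⟩ := hQ.2 κ hκ
    refine ⟨C + C', by positivity, fun z => ?_⟩
    simp only [map_add]
    refine (norm_add_le _ _).trans ?_
    rw [add_mul]
    exact add_le_add (h z) (h' z)
  | mul_X P j hP =>
    refine ⟨by simpa using hP.1.fun_mul (by fun_prop : Differentiable ℂ fun z : Cd d => z j),
      fun κ hκ => ?_⟩
    obtain ⟨C, hC, h⟩ := hP.2 (κ / 2) (by positivity)
    refine ⟨C * (1 + 1 / κ), by positivity, fun z => ?_⟩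
    simp only [map_mul, MvPolynomial.eval_X, norm_mul]
    have h1 : ‖z j‖ ≤ (1 + 1 / κ) * Real.exp (κ / 2 * ‖z‖ ^ 2) := by
      have hz : ‖z j‖ ≤ ‖z‖ := PiLp.norm_apply_le z j
      have he := Real.add_one_le_exp (κ / 2 * ‖z‖ ^ 2)
      have : ‖z‖ ≤ (1 + 1 / κ) * (κ / 2 * ‖z‖ ^ 2 + 1) := by
        have e : (1 + 1 / κ) * (κ / 2 * ‖z‖ ^ 2 + 1)
          = κ / 2 * ‖z‖ ^ 2 + 1 + ‖z‖ ^ 2 / 2 + 1 / κ := by field_simp; ring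
        rw [e]
        have : 0 ≤ κ / 2 * ‖z‖ ^ 2 := by positivity
        have : 0 ≤ 1 / κ := by positivity
        nlinarith [sq_nonneg (‖z‖ - 1)]
      exact hz.trans (this.trans (by gcongr))
    calc _ ≤ C * Real.exp (κ / 2 * ‖z‖ ^ 2) * ((1 + 1 / κ) * Real.exp (κ / 2 * ‖z‖ ^ 2)) :=
          mul_le_mul (h z) h1 (norm_nonneg _) (by positivity)
      _ = C * (1 + 1 / κ) * (Real.exp (κ / 2 * ‖z‖ ^ 2) * Real.exp (κ / 2 * ‖z‖ ^ 2)) := by ring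
      _ = _ := by rw [← Real.exp_add]; congr 2; ring

lemma polynomials_subset_A {ω : Cd d → ℝ} (hω : IsWeaklySubgaussian ω) (B : MixedSpace d) :
    polynomials d ⊆ A ω B := by
  intro F hF
  obtain ⟨hd, hg⟩ := exists_gaussian_bound_of_mem_polynomials hF
  obtain ⟨C, hC, h⟩ := hg (1 / 4) (by norm_num)
  obtain ⟨K, hK⟩ := exists_normA_le_of_gaussian hω B (κ := 1 / 4) (by norm_num)
  exact ⟨hd, (hK F C hC h).trans_lt (ENNReal.mul_lt_top ENNReal.ofReal_lt_top ENNReal.coe_lt_top)⟩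

/-- Elements of `A(ω, ℬ)` grow slower than any Gaussian `e^{a|z|²}` with `a > 1 / 2`. -/
lemma exists_growth_of_mem_A {ω : Cd d → ℝ} (hω : IsWeaklySubgaussian ω) {B : MixedSpace d}
    {F : Cd d → ℂ} (hF : F ∈ A ω B) {a : ℝ} (ha : 1 / 2 < a) :
    ∃ C : ℝ, ∀ w, ‖F w‖ ≤ C * Real.exp (a * ‖w‖ ^ 2) := by
  -- A single exponent below all the finitely many positive `p j`, possibly less than 1.
  obtain ⟨r, hr0, hr⟩ : ∃ r : ℝ, 0 < r ∧ ∀ j, ENNReal.ofReal r ≤ B.p j := by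
    have h : ∀ᶠ r : ℝ in 𝓝[>] 0, ∀ j, ENNReal.ofReal r ≤ B.p j := by
      refine eventually_all.2 fun j => ?_
      have : Tendsto ENNReal.ofReal (𝓝[>] 0) (𝓝 0) := by
        simpa using (ENNReal.continuous_ofReal.tendsto 0).mono_left nhdsWithin_le_nhds
      exact (this.eventually (gt_mem_nhds (B.p_pos j))).mono fun r hr => hr.le
    obtain ⟨r, hr, hr'⟩ := (h.and self_mem_nhdsWithin).exists
    exact ⟨r, hr', hr⟩
  set b := (1 / 2 + a) / 2 with hb
  have hb1 : 1 / 2 < b := by rw [hb]; linarith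
  refine exists_growth_of_lintegral hF.1 hr0 (b := b) (by linarith) (by rw [hb]; linarith) ?_
  -- The surplus decay $b/2-1/4=2c$ is shared: one `c` compensates the lower bound of the weight,
  -- the other supplies the Gaussian factor in Hölder's inequality.
  set c := (b / 2 - 1 / 4) / 2 with hc
  have hc0 : 0 < c := by rw [hc]; linarith
  obtain ⟨C₀, hC₀, hbd⟩ := hω.subgaussian c hc0
  -- The Hölder partner, $1/q_j=1/r-1/p_j$; it is infinite where `p j` equals `r`.
  set q : Fin B.n → ℝ≥0∞ := fun j => ((ENNReal.ofReal r)⁻¹ - (B.p j)⁻¹)⁻¹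
  obtain ⟨K, hK⟩ := B.exists_lintegral_rpow_le (q := q) hr0 fun j => ⟨by
    rw [inv_inv]
    exact add_tsub_cancel_of_le (ENNReal.inv_le_inv.2 (hr j))⟩
  have hgm : Measurable fun z : Cd d => ENNReal.ofReal (Real.exp (-(c * ‖z‖ ^ 2))) := by fun_prop
  have h1 := hK _ _ (aemeasurable_eModulus hω.isWeight.aemeasurable hF.1.continuous)
    hgm.aemeasurable
  rw [← normA_eq hω.isWeight.pos] at h1
  have h2 : ∫⁻ z, (eModulus ω F z * ENNReal.ofReal (Real.exp (-(c * ‖z‖ ^ 2)))) ^ r < ∞ := by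
    refine h1.trans_lt (ENNReal.mul_lt_top ENNReal.coe_lt_top
      (ENNReal.rpow_lt_top_of_nonneg hr0.le (ENNReal.mul_lt_top hF.2 ?_).ne))
    exact mixedNorm_gaussian_lt_top B.isInternal q hc0
  obtain ⟨c₂, hc₂, hcv⟩ := exists_lintegral_comp_bargmannArg d
  set c₁ : ℝ := (2 * Real.pi) ^ (-(d : ℝ) / 2) with hc₁
  have hc₁0 : 0 < c₁ := by positivity
  have hFc := hF.1.continuous
  have h3 := hcv (fun z => ENNReal.ofReal (‖F z‖ * Real.exp (-(b * ‖z‖ ^ 2))) ^ r)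
    ((Continuous.measurable (f := fun z => ‖F z‖ * Real.exp (-(b * ‖z‖ ^ 2)))
      (by fun_prop)).ennreal_ofReal.pow_const r)
  have h4 : ∫⁻ z, ENNReal.ofReal (‖F (bargmannArg z)‖ *
      Real.exp (-(b * ‖bargmannArg z‖ ^ 2))) ^ r < ∞ := by
    refine lt_of_le_of_lt (lintegral_mono (g := fun z => ENNReal.ofReal (c₁⁻¹ * C₀) ^ r *
      (eModulus ω F z * ENNReal.ofReal (Real.exp (-(c * ‖z‖ ^ 2)))) ^ r) fun z => ?_) ?_
    · beta_reduce
      rw [← ENNReal.mul_rpow_of_nonneg _ _ hr0.le, eModulus,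
        ← ENNReal.ofReal_mul' (Real.exp_pos _).le, ← ENNReal.ofReal_mul (by positivity)]
      refine ENNReal.rpow_le_rpow (ENNReal.ofReal_le_ofReal ?_) hr0.le
      rw [norm_bargmannArg_sq, weightedModulus, ← hc₁]
      have h5 : 1 ≤ C₀ * Real.exp (c * ‖z‖ ^ 2) * ω z := by
        have := (hbd z).1
        rw [Real.exp_neg, ← mul_inv, inv_le_iff_one_le_mul₀ (by positivity)] at this
        linarith
      calc ‖F (bargmannArg z)‖ * Real.exp (-(b * (‖z‖ ^ 2 / 2)))
          ≤ ‖F (bargmannArg z)‖ * Real.exp (-(b * (‖z‖ ^ 2 / 2))) *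
            (C₀ * Real.exp (c * ‖z‖ ^ 2) * ω z) := le_mul_of_one_le_right (by positivity) h5
        _ = C₀ * ‖F (bargmannArg z)‖ * ω z *
            (Real.exp (-(b * (‖z‖ ^ 2 / 2))) * Real.exp (c * ‖z‖ ^ 2)) := by ring
        _ = C₀ * ‖F (bargmannArg z)‖ * ω z *
            (Real.exp (-(‖z‖ ^ 2 / 4)) * Real.exp (-(c * ‖z‖ ^ 2))) := by
          rw [← Real.exp_add, ← Real.exp_add]
          congr 2
          rw [hc]; ring
        _ = _ := by field_simp
    · rw [lintegral_const_mul' _ _ (ENNReal.rpow_ne_top_of_nonneg hr0.le ENNReal.ofReal_ne_top)]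
      exact ENNReal.mul_lt_top (ENNReal.rpow_lt_top_of_nonneg hr0.le ENNReal.ofReal_ne_top) h2
  rw [h3] at h4
  exact (ENNReal.mul_lt_top_iff.1 h4).elim (fun h => h.2) fun h => h.elim
    (fun h => absurd (by simpa using h) hc₂) fun h => by rw [h]; exact ENNReal.zero_lt_top

/-- Dilations by `t < 1` of elements of `A(ω, ℬ)` are limits of polynomials. -/
lemma exists_polynomial_normA_lt {ω : Cd d → ℝ} (hω : IsWeaklySubgaussian ω) {B : MixedSpace d}
    {F : Cd d → ℂ} (hF : F ∈ A ω B) {t : ℝ} (ht : t ∈ Ioo (0 : ℝ) 1) {ε : ℝ≥0∞} (hε : 0 < ε) :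
    ∃ P ∈ polynomials d, normA ω B (P - dilate t F) < ε := by
  obtain ⟨ht0, ht1⟩ := ht
  have htsq : t ^ 2 < 1 := by nlinarith
  have htsq0 : 0 < t ^ 2 := by positivity
  -- Chosen so that $a>1/2$, as the growth estimate requires, while $t^2a=(1+t^2)/4<1/2$ is the rate
  -- of the dilate.
  set a := (1 + t ^ 2) / (4 * t ^ 2) with ha
  have hta : t ^ 2 * a = (1 + t ^ 2) / 4 := by rw [ha]; field_simp
  obtain ⟨C, hC⟩ := exists_growth_of_mem_A hω hF (a := a) (by
    rw [ha, lt_div_iff₀ (by positivity)]; linarith)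
  have hFd := hF.1
  have hd : Differentiable ℂ (dilate t F) := by
    have : Differentiable ℂ fun z : Cd d => F ((t : ℂ) • z) := by fun_prop
    exact this
  have hgr : ∀ z, ‖dilate t F z‖ ≤ C * Real.exp (t ^ 2 * a * ‖z‖ ^ 2) := by
    intro z
    refine (hC (t • z)).trans (le_of_eq ?_)
    rw [norm_smul, mul_pow, Real.norm_eq_abs, sq_abs]
    congr 2; ring
  set κ' := (t ^ 2 * a + 1 / 2) / 2 with hκ'
  obtain ⟨K, hK⟩ := exists_normA_le_of_gaussian hω B (κ := κ') (by rw [hκ', hta]; linarith)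
  obtain ⟨δ, hδ0, hδ⟩ := ENNReal.exists_nnreal_pos_mul_lt (ENNReal.coe_ne_top (r := K)) hε.ne'
  obtain ⟨P, hP, hPF⟩ := exists_polynomial_approx hd (κ' := κ') (by rw [hta]; positivity)
    (by rw [hκ', hta]; linarith) hgr (δ := δ) (by exact_mod_cast hδ0)
  refine ⟨P, hP, (hK _ δ δ.2 hPF).trans_lt ?_⟩
  rwa [ENNReal.ofReal_coe_nnreal]

end WeightedModulus

section Dilation

variable {d : ℕ}

/-! ### Dilations -/

lemma dilate_differentiable {F : Cd d → ℂ} (hF : Differentiable ℂ F) (t : ℝ) :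
    Differentiable ℂ (dilate t F) := by
  have : Differentiable ℂ fun z : Cd d => F ((t : ℂ) • z) := by fun_prop
  exact this

/-- The pointwise estimate behind the boundedness of dilations. -/
lemma exists_eModulus_dilate_le {ω : Cd d → ℝ} (hω : ∀ z, 0 < ω z) (hdil : DilatedSuitable ω) :
    ∃ (K : NNReal) (t₀ : ℝ), 1 / 2 ≤ t₀ ∧ t₀ < 1 ∧ ∀ t ∈ Ioo t₀ 1, ∀ (F : Cd d → ℂ) (z : Cd d),
      eModulus ω (dilate t F) z ≤ K * eModulus ω F (t • z) := by
  obtain ⟨ε, -, hε1, C, θ, hC, hθ0, hθ1, h⟩ := hdil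
  refine ⟨C.toNNReal, max (1 / 2) (1 - θ), le_max_left _ _, max_lt (by norm_num) (by linarith),
    fun t ht F z => ?_⟩
  have ht1 : t < 1 := ht.2
  have htθ : 1 - θ < t := (le_max_right _ _).trans_lt ht.1
  have ht0 : 0 < t := by linarith
  have hs : Real.sqrt 2 ≠ 0 := by positivity
  -- At $x=2^{-1/2}z$ the hypothesis compares $\omega(z)$ with $\omega(tz)$, with the factor
  -- $e^{-\varepsilon(1-t^2)|z|^2/4}$.
  have h1 := h t htθ ht1 ((Real.sqrt 2)⁻¹ • z)
  have e1 : Real.sqrt 2 • (Real.sqrt 2)⁻¹ • z = z := smul_inv_smul₀ hs z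
  have e2 : (Real.sqrt 2 * t) • (Real.sqrt 2)⁻¹ • z = t • z := by
    rw [mul_comm, mul_smul, e1]
  have e3 : ‖(Real.sqrt 2)⁻¹ • z‖ ^ 2 = ‖z‖ ^ 2 / 2 := by
    rw [norm_smul, mul_pow, norm_inv, Real.norm_of_nonneg (Real.sqrt_nonneg 2), inv_pow,
      Real.sq_sqrt zero_le_two]
    ring
  rw [e1, e2, e3, div_le_iff₀ (hω _)] at h1
  change _ ≤ ENNReal.ofReal C * _
  rw [eModulus, eModulus, ← ENNReal.ofReal_mul hC.le]
  refine ENNReal.ofReal_le_ofReal ?_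
  rw [weightedModulus, weightedModulus, bargmannArg_smul]
  change _ * ‖F (t • bargmannArg z)‖ * _ ≤ _
  have h2 : Real.exp (-(‖z‖ ^ 2 / 4)) * ω z ≤ C * (Real.exp (-(‖t • z‖ ^ 2 / 4)) * ω (t • z)) := by
    have e4 : ‖t • z‖ ^ 2 = t ^ 2 * ‖z‖ ^ 2 := by
      rw [norm_smul, mul_pow, Real.norm_eq_abs, sq_abs]
    -- Passing from $e^{-|tz|^2/4}$ to $e^{-|z|^2/4}$ gains $e^{-(1-t^2)|z|^2/4}$, which is the
    -- factor needed for $\varepsilon=1$ and suffices for $\varepsilon\le1$.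
    have h3 : Real.exp (-(‖z‖ ^ 2 / 4)) ≤ Real.exp (-(‖t • z‖ ^ 2 / 4)) *
        Real.exp (-(ε * (1 - t ^ 2) * (‖z‖ ^ 2 / 2) / 2)) := by
      rw [← Real.exp_add, Real.exp_le_exp, e4]
      have : 0 ≤ (1 - ε) * (1 - t ^ 2) * ‖z‖ ^ 2 := by
        have : 0 ≤ 1 - t ^ 2 := by nlinarith
        have : 0 ≤ 1 - ε := by linarith
        positivity
      linarith
    calc _ ≤ Real.exp (-(‖t • z‖ ^ 2 / 4)) *
          Real.exp (-(ε * (1 - t ^ 2) * (‖z‖ ^ 2 / 2) / 2)) * ω z := by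
          gcongr; exact (hω z).le
      _ = Real.exp (-(‖t • z‖ ^ 2 / 4)) *
          (ω z * Real.exp (-(ε * (1 - t ^ 2) * (‖z‖ ^ 2 / 2) / 2))) := by ring
      _ ≤ Real.exp (-(‖t • z‖ ^ 2 / 4)) * (C * ω (t • z)) := by gcongr
      _ = _ := by ring
  calc _ = (2 * Real.pi) ^ (-(d : ℝ) / 2) * ‖F (t • bargmannArg z)‖ *
        (Real.exp (-(‖z‖ ^ 2 / 4)) * ω z) := by ring
    _ ≤ (2 * Real.pi) ^ (-(d : ℝ) / 2) * ‖F (t • bargmannArg z)‖ *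
        (C * (Real.exp (-(‖t • z‖ ^ 2 / 4)) * ω (t • z))) := by gcongr
    _ = _ := by ring

lemma exists_normA_dilate_le {ω : Cd d → ℝ} (hω : ∀ z, 0 < ω z) (hdil : DilatedSuitable ω)
    (B : MixedSpace d) :
    ∃ (K : NNReal) (t₀ : ℝ), t₀ < 1 ∧ ∀ t ∈ Ioo t₀ 1, ∀ F : Cd d → ℂ,
      normA ω B (dilate t F) ≤ K * normA ω B F := by
  obtain ⟨K, t₀, ht₀, ht₀1, h⟩ := exists_eModulus_dilate_le hω hdil
  obtain ⟨K', hK'⟩ := B.exists_enormM_comp_smul_le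
  refine ⟨K * K', t₀, ht₀1, fun t ht F => ?_⟩
  rw [normA_eq hω, normA_eq hω, ENNReal.coe_mul, mul_assoc]
  refine (MixedSpace.enormM_mono (h t ht F)).trans ((MixedSpace.enormM_const_mul_le _ _).trans ?_)
  gcongr
  exact hK' t (ht₀.trans ht.1.le) ht.2.le (eModulus ω F)

/-- Dilations by `t ∈ (0, 1)` preserve `A(ω, ℬ)`. -/
lemma dilate_mem_A {ω : Cd d → ℝ} (hω : ∀ z, 0 < ω z) (hdil : DilatedSuitable ω)
    {B : MixedSpace d} {F : Cd d → ℂ} (hF : F ∈ A ω B) {t : ℝ} (ht : t ∈ Ioo (0 : ℝ) 1) :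
    dilate t F ∈ A ω B := by
  obtain ⟨K, t₀, ht₀, h⟩ := exists_normA_dilate_le hω hdil B
  -- The norm bound holds only for dilations near 1, so `t` is written as a power of some `s` in
  -- that range.
  have hlim : Tendsto (fun n : ℕ => t ^ (1 / ((n : ℝ) + 1))) atTop (𝓝 1) := by
    have := (Real.continuousAt_const_rpow (b := 0) ht.1.ne').tendsto.comp
      tendsto_one_div_add_atTop_nhds_zero_nat
    simpa [Function.comp_def] using this
  obtain ⟨n, hn⟩ := (hlim.eventually (lt_mem_nhds ht₀)).exists
  set s := t ^ (1 / ((n : ℝ) + 1)) with hs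
  have hs1 : s < 1 := Real.rpow_lt_one ht.1.le ht.2 (by positivity)
  have hst : s ^ (n + 1) = t := by
    rw [hs, ← Real.rpow_natCast, ← Real.rpow_mul ht.1.le]
    push_cast
    rw [one_div_mul_cancel (by positivity), Real.rpow_one]
  have hpow : ∀ m : ℕ, dilate (s ^ m) F ∈ A ω B := by
    intro m
    induction m with
    | zero =>
      have e : dilate (s ^ 0) F = F := by
        funext z
        simp [dilate]
      rwa [e]
    | succ m ih =>
      have e : dilate (s ^ (m + 1)) F = dilate s (dilate (s ^ m) F) := by
        funext z
        simp [dilate, pow_succ, mul_smul]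
      rw [e]
      exact ⟨dilate_differentiable ih.1 s, (h s ⟨hn, hs1⟩ _).trans_lt
        (ENNReal.mul_lt_top ENNReal.coe_lt_top ih.2)⟩
  rw [← hst]
  exact hpow _

/-- On bounded sets dilations converge in the norm of `A(ω, ℬ)`. -/
lemma tendsto_enormM_dilate_sub_of_norm_le {ω : Cd d → ℝ} (hω : IsWeaklySubgaussian ω)
    (B : MixedSpace d) {F : Cd d → ℂ} (hF : Continuous F) (R : ℝ) :
    Tendsto (fun t : ℝ => B.enormM ({z | ‖z‖ ≤ R}.indicator (eModulus ω (dilate t F - F))))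
      (𝓝[<] 1) (𝓝 0) := by
  -- The constant function 1 has finite norm, so uniform smallness of the difference on a ball gives
  -- smallness in norm.
  obtain ⟨K, hK⟩ := exists_normA_le_of_gaussian hω B (κ := 0) (by norm_num)
  have h1 : normA ω B 1 ≠ ∞ := ((hK 1 1 zero_le_one (by simp)).trans_lt
    (ENNReal.mul_lt_top ENNReal.ofReal_lt_top ENNReal.coe_lt_top)).ne
  refine ENNReal.tendsto_nhds_zero.2 fun ε hε => ?_
  obtain ⟨δ, hδ0, hδ⟩ := ENNReal.exists_nnreal_pos_mul_lt h1 hε.ne'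
  have hev : ∀ᶠ t : ℝ in 𝓝 1, ∀ w ∈ Metric.closedBall (0 : Cd d) R, ‖F (t • w) - F w‖ < δ := by
    refine (isCompact_closedBall _ _).eventually_forall_of_forall_eventually fun w _ => ?_
    have hc : Continuous fun p : ℝ × Cd d => ‖F (p.1 • p.2) - F p.2‖ := by fun_prop
    have := hc.tendsto (1, w)
    simp only [one_smul, sub_self, norm_zero] at this
    exact this.eventually (gt_mem_nhds (by exact_mod_cast hδ0))
  filter_upwards [nhdsWithin_le_nhds hev] with t ht
  refine le_trans ?_ hδ.le
  rw [normA_eq hω.isWeight.pos]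
  refine (MixedSpace.enormM_mono fun z => ?_).trans (MixedSpace.enormM_const_mul_le _ _)
  refine indicator_apply_le' (fun hz => ?_) (fun _ => bot_le)
  have hz' : ‖bargmannArg z‖ ≤ R := by
    have hR : 0 ≤ R := (norm_nonneg z).trans hz
    have h2 := norm_bargmannArg_sq z
    have hzR : ‖z‖ ≤ R := hz
    nlinarith [norm_nonneg z, norm_nonneg (bargmannArg z)]
  have := eModulus_le_mul hω.isWeight.pos (F := dilate t F - F) (G := 1) (z := z) δ.2 (by
    simpa [dilate] using (ht _ (by simpa using hz')).le)
  simpa using this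

/-- Dilations are uniformly small near infinity. -/
lemma exists_enormM_tail_dilate_le {ω : Cd d → ℝ} (hω : ∀ z, 0 < ω z) (hdil : DilatedSuitable ω)
    (B : MixedSpace d) : ∃ (K : NNReal) (t₀ : ℝ), t₀ < 1 ∧ ∀ t ∈ Ioo t₀ 1, ∀ (F : Cd d → ℂ) (k : ℝ),
      B.enormM ({z | 2 * k < ‖z‖}.indicator (eModulus ω (dilate t F))) ≤
        K * B.enormM ({z | k < ‖z‖}.indicator (eModulus ω F)) := by
  obtain ⟨K, t₀, ht₀, ht₀1, h⟩ := exists_eModulus_dilate_le hω hdil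
  obtain ⟨K', hK'⟩ := B.exists_enormM_comp_smul_le
  refine ⟨K * K', t₀, ht₀1, fun t ht F k => ?_⟩
  have ht2 : 1 / 2 ≤ t := ht₀.trans ht.1.le
  rw [ENNReal.coe_mul, mul_assoc]
  refine (MixedSpace.enormM_mono fun z => ?_).trans ((MixedSpace.enormM_const_mul_le K
    fun z => {z | k < ‖z‖}.indicator (eModulus ω F) (t • z)).trans ?_)
  · refine indicator_apply_le' (fun hz => ?_) (fun _ => bot_le)
    have hz' : 2 * k < ‖z‖ := hz
    -- Since `t ≥ 1 / 2`, points outside the ball of radius `2 * k` stay outside that of radius `k`.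
    have : t • z ∈ {z : Cd d | k < ‖z‖} := by
      change k < ‖t • z‖
      rw [norm_smul, Real.norm_of_nonneg (by linarith)]
      nlinarith [norm_nonneg z]
    rw [indicator_of_mem this]
    exact h t ht F z
  · gcongr
    exact hK' t ht2 ht.2.le ({z | k < ‖z‖}.indicator (eModulus ω F))

/-- Dilations converge in the norm of `A(ω, ℬ)` when all exponents are finite. -/
lemma tendsto_normA_dilate_sub {ω : Cd d → ℝ} (hω : IsWeaklySubgaussian ω)
    (hdil : DilatedSuitable ω) {B : MixedSpace d} (hB : B.nu2 < ∞) {F : Cd d → ℂ}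
    (hF : F ∈ A ω B) :
    Tendsto (fun t : ℝ => normA ω B (dilate t F - F)) (𝓝[<] 1) (𝓝 0) := by
  have hpos := hω.isWeight.pos
  have hFc := hF.1.continuous
  obtain ⟨K, hK⟩ := B.exists_enormM_add_le
  obtain ⟨K', t₀, ht₀, hK'⟩ := exists_enormM_tail_dilate_le hpos hdil B
  have hm := fun G (hG : Continuous G) => aemeasurable_eModulus hω.isWeight.aemeasurable (F := G) hG
  have hfin : B.enormM (eModulus ω F) < ∞ := by rw [← normA_eq hpos]; exact hF.2
  have htail := MixedSpace.tendsto_enormM_tail hB (hm F hFc) hfin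
  have hms : ∀ k : ℝ, MeasurableSet {z : Cd d | k < ‖z‖} := fun k =>
    measurableSet_lt measurable_const measurable_norm
  have hms' : ∀ k : ℝ, MeasurableSet {z : Cd d | ‖z‖ ≤ k} := fun k =>
    measurableSet_le measurable_norm measurable_const
  -- The constant collects two uses of the quasi-triangle inequality and the bound `K'` for the tail
  -- of the dilate. The cutoff `k` is fixed first, and only then does `t` tend to 1.
  have htail' := ENNReal.Tendsto.const_mul (a := (K * (K * (K' + 1)) : NNReal)) htail
    (Or.inr ENNReal.coe_ne_top)
  rw [mul_zero] at htail'
  refine ENNReal.tendsto_nhds_zero.2 fun ε hε => ?_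
  have hε2 : 0 < ε / 2 := ENNReal.half_pos hε.ne'
  obtain ⟨k, hk⟩ := ((ENNReal.tendsto_nhds_zero.1 htail') _ hε2).exists
  have hloc := ENNReal.Tendsto.const_mul (a := (K : ℝ≥0∞))
    (tendsto_enormM_dilate_sub_of_norm_le hω B hFc (2 * k)) (Or.inr ENNReal.coe_ne_top)
  rw [mul_zero] at hloc
  filter_upwards [(ENNReal.tendsto_nhds_zero.1 hloc) _ hε2, Ioo_mem_nhdsLT ht₀] with t ht ht'
  have hdc : Continuous (dilate t F) := (dilate_differentiable hF.1 t).continuous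
  set T := B.enormM ({z | (k : ℝ) < ‖z‖}.indicator (eModulus ω F))
  have hsplit : ∀ z, eModulus ω (dilate t F - F) z ≤
      {z | ‖z‖ ≤ 2 * (k : ℝ)}.indicator (eModulus ω (dilate t F - F)) z +
      ({z | 2 * (k : ℝ) < ‖z‖}.indicator (eModulus ω (dilate t F)) z +
        {z | (k : ℝ) < ‖z‖}.indicator (eModulus ω F) z) := by
    intro z
    by_cases hz : ‖z‖ ≤ 2 * (k : ℝ)
    · rw [indicator_of_mem (s := {z : Cd d | ‖z‖ ≤ 2 * (k : ℝ)}) hz]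
      exact le_self_add
    · have hz' := not_le.1 hz
      have hz'' : (k : ℝ) < ‖z‖ := by
        have : (0 : ℝ) ≤ k := Nat.cast_nonneg k
        linarith
      rw [indicator_of_mem (s := {z : Cd d | 2 * (k : ℝ) < ‖z‖}) hz',
        indicator_of_mem (s := {z : Cd d | (k : ℝ) < ‖z‖}) hz'']
      exact (eModulus_sub_le hpos _ _ z).trans le_add_self
  rw [normA_eq hpos]
  calc _ ≤ _ := MixedSpace.enormM_mono hsplit
    _ ≤ K * (B.enormM ({z | ‖z‖ ≤ 2 * (k : ℝ)}.indicator (eModulus ω (dilate t F - F))) +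
          K * (B.enormM ({z | 2 * (k : ℝ) < ‖z‖}.indicator (eModulus ω (dilate t F))) + T)) := by
        refine (hK _ _ ((hm _ (hdc.sub hFc)).indicator (hms' _))
          (((hm _ hdc).indicator (hms _)).add ((hm _ hFc).indicator (hms _)))).trans ?_
        gcongr
        exact hK _ _ ((hm _ hdc).indicator (hms _)) ((hm _ hFc).indicator (hms _))
    _ ≤ K * (B.enormM ({z | ‖z‖ ≤ 2 * (k : ℝ)}.indicator (eModulus ω (dilate t F - F))) +
          K * (K' * T + T)) := by
        gcongr
        exact hK' t ht' F k
    _ = K * B.enormM ({z | ‖z‖ ≤ 2 * (k : ℝ)}.indicator (eModulus ω (dilate t F - F))) +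
          (K * (K * (K' + 1)) : NNReal) * T := by push_cast; ring
    _ ≤ ε / 2 + ε / 2 := add_le_add ht hk
    _ = ε := ENNReal.add_halves ε

end Dilation

section WeakStar

variable {d : ℕ}

/-! ### The `A²` form and weak* convergence -/

lemma continuous_formIntegrand {G F : Cd d → ℂ} (hG : Continuous G) (hF : Continuous F) :
    Continuous (formIntegrand G F) := by
  unfold formIntegrand
  have h : Continuous fun z : Cd d => (Real.pi ^ d)⁻¹ * Real.exp (-‖z‖ ^ 2) := by fun_prop
  exact (hG.mul (Complex.continuous_conj.comp hF)).mul (Complex.continuous_ofReal.comp h)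

/-- The `A²` form is controlled by the pairing of the weighted moduli. -/
lemma exists_lintegral_formIntegrand_le {ω : Cd d → ℝ} (hω : ∀ z, 0 < ω z) :
    ∃ K : NNReal, ∀ G F : Cd d → ℂ, Continuous G → Continuous F →
      ∫⁻ z, ‖formIntegrand G F z‖ₑ ≤
        K * ∫⁻ z, eModulus (fun z => (ω z)⁻¹) F z * eModulus ω G z := by
  obtain ⟨c, hc, h⟩ := exists_lintegral_comp_bargmannArg d
  set c₁ : ℝ := (2 * Real.pi) ^ (-(d : ℝ) / 2) with hc₁
  have hc₁0 : 0 < c₁ := by positivity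
  refine ⟨c⁻¹ * ((c₁ ^ 2)⁻¹ * (Real.pi ^ d)⁻¹).toNNReal, fun G F hG hF => ?_⟩
  have h1 := h _ (continuous_formIntegrand hG hF).enorm.measurable
  have h2 : ∫⁻ z, ‖formIntegrand G F z‖ₑ = (c : ℝ≥0∞)⁻¹ *
      ∫⁻ z, ‖formIntegrand G F (bargmannArg z)‖ₑ := by
    rw [h1, ← mul_assoc, ENNReal.inv_mul_cancel (by simpa using hc) (by simp), one_mul]
  rw [h2, ENNReal.coe_mul, ENNReal.coe_inv hc, mul_assoc,
    ← lintegral_const_mul' _ _ ENNReal.coe_ne_top]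
  gcongr with z
  change _ ≤ ENNReal.ofReal _ * _
  have hz := (hω z).ne'
  rw [eModulus, eModulus, ← ENNReal.ofReal_mul (by
      have := (hω z).le; unfold weightedModulus; positivity),
    ← ENNReal.ofReal_mul (by positivity), ← ofReal_norm]
  refine ENNReal.ofReal_le_ofReal (le_of_eq ?_)
  rw [formIntegrand, norm_mul, norm_mul, RCLike.norm_conj, Complex.norm_real,
    Real.norm_of_nonneg (by positivity), norm_bargmannArg_sq, weightedModulus, weightedModulus,
    ← hc₁]
  -- At the argument of $U^{-1}$ the Gaussian of the form splits evenly between the two factors, and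
  -- the weights $\omega$ and $1/\omega$ cancel.
  have e : Real.exp (-(‖z‖ ^ 2 / 2)) = Real.exp (-(‖z‖ ^ 2 / 4)) * Real.exp (-(‖z‖ ^ 2 / 4)) := by
    rw [← Real.exp_add]; congr 1; ring
  rw [e]
  field_simp

lemma MixedSpace.exists_lintegral_mul_le {B : MixedSpace d} (hB : 1 ≤ B.nu1) :
    ∃ c : NNReal, ∀ f g : Cd d → ℝ≥0∞, AEMeasurable f volume → AEMeasurable g volume →
      ∫⁻ z, f z * g z ≤ c * (B.enormM f * B.dual.enormM g) := by
  obtain ⟨c, hc⟩ := B.exists_lintegral_rpow_le (q := B.dual.p) one_pos fun j => by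
    rw [ENNReal.ofReal_one]
    exact ENNReal.HolderConjugate.conjExponent (hB.trans (iInf_le _ j))
  exact ⟨c, fun f g hf hg => by simpa using! hc f g hf hg⟩

/-- The `A²` form is bounded on `A(ω, ℬ') × A(1/ω, ℬ)`. -/
lemma exists_lintegral_formIntegrand_le_normA {ω : Cd d → ℝ} (hω : ∀ z, 0 < ω z)
    (hm : AEMeasurable ω volume) {B : MixedSpace d} (hB : 1 ≤ B.nu1) :
    ∃ K : NNReal, ∀ G F : Cd d → ℂ, Continuous G → Continuous F →
      ∫⁻ z, ‖formIntegrand G F z‖ₑ ≤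
        K * (normA (fun z => (ω z)⁻¹) B F * normA ω B.dual G) := by
  obtain ⟨K, hK⟩ := exists_lintegral_formIntegrand_le hω
  obtain ⟨c, hc⟩ := MixedSpace.exists_lintegral_mul_le hB
  refine ⟨K * c, fun G F hG hF => (hK G F hG hF).trans ?_⟩
  rw [ENNReal.coe_mul, mul_assoc, normA_eq hω, normA_eq fun z => inv_pos.2 (hω z)]
  gcongr
  exact hc _ _ (aemeasurable_eModulus hm.inv hF) (aemeasurable_eModulus hm hG)

lemma integrable_formIntegrand {ω : Cd d → ℝ} (hω : ∀ z, 0 < ω z) (hm : AEMeasurable ω volume)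
    {B : MixedSpace d} (hB : 1 ≤ B.nu1) {G F : Cd d → ℂ} (hG : G ∈ A ω B.dual)
    (hF : F ∈ A (fun z => (ω z)⁻¹) B) : Integrable (formIntegrand G F) volume := by
  obtain ⟨K, hK⟩ := exists_lintegral_formIntegrand_le_normA hω hm hB
  refine ⟨(continuous_formIntegrand hG.1.continuous hF.1.continuous).aestronglyMeasurable,
    (hK G F hG.1.continuous hF.1.continuous).trans_lt ?_⟩
  exact ENNReal.mul_lt_top ENNReal.coe_lt_top (ENNReal.mul_lt_top hF.2 hG.2)

lemma edist_formA2_le {ω : Cd d → ℝ} (hω : ∀ z, 0 < ω z) (hm : AEMeasurable ω volume)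
    {B : MixedSpace d} (hB : 1 ≤ B.nu1) {G G' F : Cd d → ℂ} (hG : G ∈ A ω B.dual)
    (hG' : G' ∈ A ω B.dual) (hF : F ∈ A (fun z => (ω z)⁻¹) B) :
    edist (formA2 G F) (formA2 G' F) ≤ ∫⁻ z, ‖formIntegrand (G - G') F z‖ₑ := by
  rw [edist_eq_enorm_sub, formA2, formA2, ← integral_sub (integrable_formIntegrand hω hm hB hG hF)
    (integrable_formIntegrand hω hm hB hG' hF)]
  refine (enorm_integral_le_lintegral_enorm _).trans (le_of_eq ?_)
  refine lintegral_congr fun z => ?_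
  congr 1
  simp only [formIntegrand, Pi.sub_apply]
  ring

/-- Only `F` has small tails, its exponents being finite. Outside a large ball the tail of `F` is
paired with the bounded difference `dilate t G - G`; inside, that difference is small in norm by
uniform convergence. -/
lemma tendsto_formA2_dilate {ω : Cd d → ℝ} (hω : IsWeaklySubgaussian ω)
    (hdil : DilatedSuitable ω) {B : MixedSpace d} (hB : B.nu2 < ∞) (hB1 : 1 ≤ B.nu1)
    {G F : Cd d → ℂ} (hG : G ∈ A ω B.dual) (hF : F ∈ A (fun z => (ω z)⁻¹) B) :
    Tendsto (fun t : ℝ => formA2 (dilate t G) F) (𝓝[<] 1) (𝓝 (formA2 G F)) := by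
  have hpos := hω.isWeight.pos
  have hm := hω.isWeight.aemeasurable
  have hGc := hG.1.continuous
  have hFc := hF.1.continuous
  have hpos' : ∀ z, 0 < (ω z)⁻¹ := fun z => inv_pos.2 (hpos z)
  obtain ⟨K₁, hK₁⟩ := exists_lintegral_formIntegrand_le hpos
  obtain ⟨K₂, hK₂⟩ := MixedSpace.exists_lintegral_mul_le hB1
  obtain ⟨K₃, hK₃⟩ := exists_normA_sub_le hpos hm B.dual
  obtain ⟨K₄, t₀, ht₀, hK₄⟩ := exists_normA_dilate_le hpos hdil B.dual
  set f := eModulus (fun z => (ω z)⁻¹) F with hf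
  have hfm : AEMeasurable f volume := aemeasurable_eModulus hm.inv hFc
  have hffin : B.enormM f < ∞ := by rw [hf, ← normA_eq hpos']; exact hF.2
  have hms : ∀ k : ℝ, MeasurableSet {z : Cd d | k < ‖z‖} := fun k =>
    measurableSet_lt measurable_const measurable_norm
  have hms' : ∀ k : ℝ, MeasurableSet {z : Cd d | ‖z‖ ≤ k} := fun k =>
    measurableSet_le measurable_norm measurable_const
  -- A bound for the norm of `dilate t G - G` that does not depend on `t`.
  set N := K₃ * (K₄ * normA ω B.dual G + normA ω B.dual G) with hN
  have hNtop : N ≠ ∞ := by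
    have := hG.2.ne
    rw [hN]; finiteness
  have htail := ENNReal.Tendsto.const_mul (a := K₁ * K₂ * N)
    (MixedSpace.tendsto_enormM_tail hB hfm hffin) (Or.inr (by finiteness))
  rw [mul_zero] at htail
  refine tendsto_iff_edist_tendsto_0.2 (ENNReal.tendsto_nhds_zero.2 fun ε hε => ?_)
  have hε2 : 0 < ε / 2 := ENNReal.half_pos hε.ne'
  obtain ⟨k, hk⟩ := ((ENNReal.tendsto_nhds_zero.1 htail) _ hε2).exists
  have hloc := ENNReal.Tendsto.const_mul (a := K₁ * K₂ * B.enormM f)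
    (tendsto_enormM_dilate_sub_of_norm_le hω B.dual hGc k) (Or.inr (by finiteness))
  rw [mul_zero] at hloc
  filter_upwards [(ENNReal.tendsto_nhds_zero.1 hloc) _ hε2, Ioo_mem_nhdsLT ht₀,
    Ioo_mem_nhdsLT zero_lt_one] with t ht ht' ht01
  have hdm := dilate_mem_A hpos hdil hG ht01
  have hdc := hdm.1.continuous
  set D := eModulus ω (dilate t G - G) with hD
  have hDm : AEMeasurable D volume := aemeasurable_eModulus hm (hdc.sub hGc)
  have hDN : B.dual.enormM D ≤ N := by
    rw [hD, ← normA_eq hpos]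
    refine (hK₃ _ _ hdc hGc).trans ?_
    rw [hN]
    gcongr
    exact hK₄ t ht' G
  have hsplit : ∀ z, f z * D z ≤ f z * {z | ‖z‖ ≤ (k : ℝ)}.indicator D z +
      {z | (k : ℝ) < ‖z‖}.indicator f z * D z := by
    intro z
    by_cases hz : ‖z‖ ≤ (k : ℝ)
    · rw [indicator_of_mem (s := {z : Cd d | ‖z‖ ≤ (k : ℝ)}) hz]
      exact le_self_add
    · rw [indicator_of_mem (s := {z : Cd d | (k : ℝ) < ‖z‖}) (not_le.1 hz)]
      exact le_add_self
  calc edist (formA2 (dilate t G) F) (formA2 G F)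
      ≤ ∫⁻ z, ‖formIntegrand (dilate t G - G) F z‖ₑ := edist_formA2_le hpos hm hB1 hdm hG hF
    _ ≤ K₁ * ∫⁻ z, f z * D z := hK₁ _ _ (hdc.sub hGc) hFc
    _ ≤ K₁ * ((∫⁻ z, f z * {z | ‖z‖ ≤ (k : ℝ)}.indicator D z) +
          ∫⁻ z, {z | (k : ℝ) < ‖z‖}.indicator f z * D z) := by
        gcongr
        refine (lintegral_mono hsplit).trans_eq (lintegral_add_left' ?_ _)
        exact hfm.mul (hDm.indicator (hms' _))
    _ ≤ K₁ * (K₂ * (B.enormM f * B.dual.enormM ({z | ‖z‖ ≤ (k : ℝ)}.indicator D)) +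
          K₂ * (B.enormM ({z | (k : ℝ) < ‖z‖}.indicator f) * N)) := by
        gcongr
        · exact hK₂ _ _ hfm (hDm.indicator (hms' _))
        · refine (hK₂ _ _ (hfm.indicator (hms _)) hDm).trans ?_
          gcongr
    _ = K₁ * K₂ * B.enormM f * B.dual.enormM ({z | ‖z‖ ≤ (k : ℝ)}.indicator D) +
          K₁ * K₂ * N * B.enormM ({z | (k : ℝ) < ‖z‖}.indicator f) := by ring
    _ ≤ ε / 2 + ε / 2 := add_le_add ht hk
    _ = ε := ENNReal.add_halves ε

lemma tendsto_weakStar_iff {ω : Cd d → ℝ} {B : MixedSpace d} {ι : Type*} {l : Filter ι}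
    {u : ι → A ω B.dual} {G : A ω B.dual} :
    Tendsto u l (@nhds _ (weakStar ω B) G) ↔
      ∀ F ∈ A (fun z => (ω z)⁻¹) B, Tendsto (fun i => formA2 (u i).1 F) l (𝓝 (formA2 G.1 F)) := by
  rw [weakStar, nhds_iInf, tendsto_iInf]
  simp only [nhds_induced, tendsto_comap_iff, Subtype.forall]
  rfl

end WeakStar

end BargmannFock

end

/-! ### Density of polynomials and convergence of dilations -/

theorem mainTheorem5 (d : ℕ) (ω : Cd d → ℝ) (hω : IsWeaklySubgaussian ω)
    (hdil : DilatedSuitable ω) (B : MixedSpace d) (hB : B.nu2 < ∞) :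
    -- polynomials are dense in `A(ω, ℬ)`
    (polynomials d ⊆ A ω B ∧
      ∀ F ∈ A ω B, ∀ ε : ℝ≥0∞, 0 < ε → ∃ P ∈ polynomials d, normA ω B (P - F) < ε) ∧
    -- dilations converge in `A(ω, ℬ)`
    (∀ F ∈ A ω B, (∀ t ∈ Ioo (0 : ℝ) 1, dilate t F ∈ A ω B) ∧
      Tendsto (fun t : ℝ => normA ω B (dilate t F - F)) (𝓝[<] 1) (𝓝 0)) ∧
    (1 ≤ B.nu1 →
      -- the form that defines the weak* topology is given by absolutely convergent integrals
      (∀ G ∈ A ω B.dual, ∀ F ∈ A (fun z => (ω z)⁻¹) B, Integrable (formIntegrand G F) volume) ∧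
      -- polynomials are weak* dense in `A(ω, ℬ')`
      (polynomials d ⊆ A ω B.dual ∧
        @Dense (A ω B.dual) (weakStar ω B) {G | (G : Cd d → ℂ) ∈ polynomials d}) ∧
      -- dilations converge in the weak* topology of `A(ω, ℬ')`
      (∀ G : A ω B.dual, ∃ h : ∀ t : Ioo (0 : ℝ) 1, dilate (t : ℝ) (G : Cd d → ℂ) ∈ A ω B.dual,
        Tendsto (fun t : Ioo (0 : ℝ) 1 => (⟨dilate (t : ℝ) (G : Cd d → ℂ), h t⟩ : A ω B.dual))
          (comap (fun t : Ioo (0 : ℝ) 1 => (t : ℝ)) (𝓝[<] 1)) (@nhds _ (weakStar ω B) G))) := by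

  have hpos := hω.isWeight.pos
  have hm := hω.isWeight.aemeasurable
  refine ⟨⟨polynomials_subset_A hω B, fun F hF ε hε => ?_⟩, fun F hF =>
    ⟨fun t ht => dilate_mem_A hpos hdil hF ht, tendsto_normA_dilate_sub hω hdil hB hF⟩,
    fun hB1 => ⟨fun G hG F hF => integrable_formIntegrand hpos hm hB1 hG hF,
      ⟨polynomials_subset_A hω B.dual, fun G => ?_⟩, fun G => ?_⟩⟩
  -- Norm density through $P-F=(P-F_t)+(F_t-F)$: `t` is fixed first, then `P`. The factor `K` of the
  -- quasi-triangle inequality is absorbed in the choice of `δ`.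
  · obtain ⟨K, hK⟩ := exists_normA_add_le hpos hm B
    obtain ⟨δ, hδ0, hδ⟩ := ENNReal.exists_nnreal_pos_mul_lt
      (ENNReal.coe_ne_top (r := K)) (ENNReal.half_pos hε.ne').ne'
    have hδ0' : (0 : ℝ≥0∞) < δ := by exact_mod_cast hδ0
    obtain ⟨t, ht, ht01⟩ := (((tendsto_normA_dilate_sub hω hdil hB hF).eventually
      (gt_mem_nhds hδ0')).and (Ioo_mem_nhdsLT zero_lt_one)).exists
    obtain ⟨P, hP, hPt⟩ := exists_polynomial_normA_lt hω hF ht01 hδ0'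
    refine ⟨P, hP, ?_⟩
    have hPc := (polynomials_subset_A hω B hP).1.continuous
    have hdc := (dilate_differentiable hF.1 t).continuous
    have h := hK (P - dilate t F) (dilate t F - F) (hPc.sub hdc) (hdc.sub hF.1.continuous)
    rw [sub_add_sub_cancel] at h
    calc normA ω B (P - F) ≤ K * (δ + δ) := h.trans (by gcongr)
      _ = δ * K + δ * K := by ring
      _ < ε / 2 + ε / 2 := ENNReal.add_lt_add hδ hδ
      _ = ε := ENNReal.add_halves ε
  -- Two closure steps: the dilates of `G` lie in the closure of the polynomials, and `G` is a limit
  -- of its dilates. As the closure is closed, no diagonal choice is needed.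
  · let _ := weakStar ω B
    have hdil_mem : ∀ t ∈ Ioo (0 : ℝ) 1, ∀ h : dilate t (G : Cd d → ℂ) ∈ A ω B.dual,
        (⟨dilate t (G : Cd d → ℂ), h⟩ : A ω B.dual) ∈
          closure {G : A ω B.dual | (G : Cd d → ℂ) ∈ polynomials d} := by
      intro t ht h
      have happ : ∀ n : ℕ, ∃ P ∈ polynomials d,
          normA ω B.dual (P - dilate t G) < ((n : ℝ≥0∞) + 1)⁻¹ := fun n =>
        exists_polynomial_normA_lt hω G.2 ht (by simp)
      -- Norm approximation of a dilate needs no finiteness of the exponents of `B.dual`. It implies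
      -- weak* approximation because the form is bounded in its first argument.
      choose P hP hPn using happ
      refine mem_closure_of_tendsto (f := fun n => (⟨P n, polynomials_subset_A hω B.dual (hP n)⟩ :
        A ω B.dual)) (b := atTop) (tendsto_weakStar_iff.2 fun F hF => ?_) (.of_forall hP)
      obtain ⟨K, hK⟩ := exists_lintegral_formIntegrand_le_normA hpos hm hB1
      rw [tendsto_iff_edist_tendsto_0]
      have hinv : Tendsto (fun n : ℕ => ((n : ℝ≥0∞) + 1)⁻¹) atTop (𝓝 0) := by
        have := (tendsto_add_atTop_iff_nat 1).2 ENNReal.tendsto_inv_nat_nhds_zero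
        simpa using this
      have hlim := ENNReal.Tendsto.const_mul (a := K * normA (fun z => (ω z)⁻¹) B F) hinv
        (Or.inr (ENNReal.mul_ne_top ENNReal.coe_ne_top hF.2.ne))
      rw [mul_zero] at hlim
      refine tendsto_of_tendsto_of_tendsto_of_le_of_le tendsto_const_nhds hlim
        (fun _ => zero_le) fun n => ?_
      have hPA := polynomials_subset_A hω B.dual (hP n)
      refine (edist_formA2_le hpos hm hB1 hPA h hF).trans ((hK _ _
        (hPA.1.continuous.sub h.1.continuous) hF.1.continuous).trans ?_)
      rw [← mul_assoc]
      gcongr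
      exact (hPn n).le
    have hmem : ∀ t ∈ Ioo (0 : ℝ) 1, dilate t (G : Cd d → ℂ) ∈ A ω B.dual :=
      fun t ht => dilate_mem_A hpos hdil G.2 ht
    have hlim : Tendsto (fun t : Ioo (0 : ℝ) 1 => (⟨dilate t G, hmem t t.2⟩ : A ω B.dual))
        (comap (fun t : Ioo (0 : ℝ) 1 => (t : ℝ)) (𝓝[<] 1)) (𝓝 G) :=
      tendsto_weakStar_iff.2 fun F hF =>
        (tendsto_formA2_dilate hω hdil hB hB1 G.2 hF).comp tendsto_comap
    -- The filter is nontrivial because `Ioo 0 1` is a left neighbourhood of 1.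
    have hne : (comap (fun t : Ioo (0 : ℝ) 1 => (t : ℝ)) (𝓝[<] 1)).NeBot := by
      refine comap_neBot_iff_frequently.2 (Eventually.frequently ?_)
      filter_upwards [Ioo_mem_nhdsLT zero_lt_one] with t ht
      exact ⟨⟨t, ht⟩, rfl⟩
    exact isClosed_closure.mem_of_tendsto hlim (.of_forall fun t => hdil_mem t t.2 _)
  · exact ⟨fun t => dilate_mem_A hpos hdil G.2 t.2, tendsto_weakStar_iff.2 fun F hF =>
      (tendsto_formA2_dilate hω hdil hB hB1 G.2 hF).comp tendsto_comap⟩
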